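/- Let $p$ be a prime and $n\ge 1$. Write $P[y_1,\dots,y_n]$ for the polynomial algebra and $E(x_1,\dots,x_n)$ for the exterior algebra over $\mathbb Z/p$; the group $GL_n=GL_n(\mathbb Z/p)$ acts on both by linear substitution of the generators. The reduced powers $P^k$ act on $P[y_1,\dots,y_n]$ by the rule that $\sum_k P^k\,T^k$ is multiplicative with $y_i\mapsto y_i+y_i^pT$; on $E(x_1,\dots,x_n)\otimes P[y_1,\dots,y_n]$ they act in the same way on the second factor and trivially on the first ($P^0=1$, $P^kx_i=0$ for $k\ge1$), and the Bockstein $\beta$ is the signed derivation with $\beta x_i=y_i$, $\beta y_i=0$. A module is called indecomposable if it is nonzero and its only direct summands are $0$ and the whole module (submodules are not required to be graded). (a) Let $p$ be odd, let $\mathcal A$ be the mod $p$ Steenrod algebra (generated by $\beta$ and the $P^k$), and let $$D_n=\bigl(E(x_1,\dots,x_n)\otimes P[y_1,\dots,y_n]\bigr)^{GL_n}$$ be the extended Dickson algebra, the algebra of $GL_n$-invariants of $H^*(B(\mathbb Z/p)^n;\mathbb Z/p)$. Then the augmentation ideal $\overline{D_n}$ (the invariants with zero constant term) is indecomposable as an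 $\mathcal A$-module. (b) For every prime $p$, the augmentation ideal of the classical Dickson algebra $P[y_1,\dots,y_n]^{GL_n}$ is indecomposable as a module over the algebra generated by the reduced powers $P^k$. For $p=2$ one has $P^k=Sq^k$, this algebra is the mod $2$ Steenrod algebra $\mathcal A$, and $P[y_1,\dots,y_n]^{GL_n}=H^*(B(\mathbb Z/2)^n;\mathbb Z/2)^{GL_n}$ is the Dickson algebra $D_n$; so (b) says that $\overline{D_n}$ is indecomposable as an $\mathcal A$-module in this case too. -/

import Mathlib

open scoped TensorProduct

noncomputable section

namespace Dickson

/-! ### Generalities: algebras of natural operations, indecomposable modules -/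

/-- The algebra of operations on the family `H 0, H 1, …` generated by a set `s` of operations;
an operation is a family of linear endomorphisms, one of each `H n`, and the product is
composition. -/
def OperationAlgebra (F : Type) [Field F] (H : ℕ → Type) [∀ n, AddCommGroup (H n)]
    [∀ n, Module F (H n)] (s : Set (∀ n, Module.End F (H n))) : Type :=
  Algebra.adjoin F s

instance (F : Type) [Field F] (H : ℕ → Type) [∀ n, AddCommGroup (H n)] [∀ n, Module F (H n)]
    (s : Set (∀ n, Module.End F (H n))) : Ring (OperationAlgebra F H s) :=
  inferInstanceAs (Ring (Algebra.adjoin F s))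

instance (F : Type) [Field F] (H : ℕ → Type) [∀ n, AddCommGroup (H n)] [∀ n, Module F (H n)]
    (s : Set (∀ n, Module.End F (H n))) : Algebra F (OperationAlgebra F H s) :=
  inferInstanceAs (Algebra F (Algebra.adjoin F s))

/-- An operation acts on `H n` through its `n`-th component. -/
@[reducible] def OperationAlgebra.module {F : Type} [Field F] {H : ℕ → Type}
    [∀ n, AddCommGroup (H n)] [∀ n, Module F (H n)] (s : Set (∀ n, Module.End F (H n))) (n : ℕ) :
    Module (OperationAlgebra F H s) (H n) :=
  Module.compHom (H n)
    ((Pi.evalRingHom (fun n => Module.End F (H n)) n).comp (Algebra.adjoin F s).val.toRingHom)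

/-- A subspace stable under the generating operations is stable under all operations. -/
theorem OperationAlgebra.stable {F : Type} [Field F] {H : ℕ → Type}
    [∀ n, AddCommGroup (H n)] [∀ n, Module F (H n)] {s : Set (∀ n, Module.End F (H n))} {n : ℕ}
    (W : Submodule F (H n)) (hW : ∀ θ ∈ s, ∀ h ∈ W, θ n h ∈ W)
    (a : OperationAlgebra F H s) : ∀ h ∈ W, a.1 n h ∈ W := by
  obtain ⟨a, ha⟩ := a
  induction ha using Algebra.adjoin_induction with
  | mem θ hθ => exact hW θ hθ
  | algebraMap r =>
    intro h hh
    exact W.smul_mem r hh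
  | add x y _ _ hx hy =>
    intro h hh
    exact W.add_mem (hx h hh) (hy h hh)
  | mul x y _ _ hx hy =>
    intro h hh
    exact hx _ (hy h hh)

/-- A module is (directly) indecomposable if it is nonzero and its only direct summands are zero
and the whole module. -/
def IsIndecomposable (R M : Type) [Ring R] [AddCommGroup M] [Module R M] : Prop :=
  Nontrivial M ∧ ∀ N N' : Submodule R M, IsCompl N N' → N = ⊥ ∨ N = ⊤

variable (p : ℕ) [Fact p.Prime]

/-! ### The polynomial algebra `P[y₁, …, yₙ]` over `ℤ/p` -/

/-- The polynomial algebra `P[y₁, …, yₙ]` over `ℤ/p`, `yᵢ = X i`. The generators have degree `2` if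
`p` is odd and degree `1` if `p = 2`; for `p = 2` this is the cohomology algebra `H^*(BVⁿ; ℤ/2)`. -/
abbrev Poly (n : ℕ) : Type := MvPolynomial (Fin n) (ZMod p)

/-- The total reduced power `f ↦ ∑ₖ Pᵏ(f) Tᵏ`: the multiplicative (Cartan formula) map with
`yᵢ ↦ yᵢ + yᵢ^p T`. -/
def totalPower (n : ℕ) : Poly p n →ₐ[ZMod p] Polynomial (Poly p n) :=
  MvPolynomial.aeval fun i =>
    Polynomial.C (MvPolynomial.X i) + Polynomial.C (MvPolynomial.X i ^ p) * Polynomial.X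

/-- The reduced power `Pᵏ` on `P[y₁, …, yₙ]`; for `p = 2` it is the Steenrod square `Sqᵏ`. -/
def polyPower (k n : ℕ) : Module.End (ZMod p) (Poly p n) :=
  ((Polynomial.lcoeff (Poly p n) k).restrictScalars (ZMod p)).comp (totalPower p n).toLinearMap

/-- Linear substitution `yⱼ ↦ ∑ᵢ gᵢⱼ yᵢ`. -/
def polyAct {n : ℕ} (g : Matrix (Fin n) (Fin n) (ZMod p)) : Poly p n →ₐ[ZMod p] Poly p n :=
  MvPolynomial.aeval fun j => ∑ i, g i j • MvPolynomial.X i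

/-- The augmentation `yᵢ ↦ 0`. -/
def polyAug (n : ℕ) : Poly p n →ₐ[ZMod p] ZMod p :=
  MvPolynomial.aeval fun _ => 0

/-- The classical Dickson algebra `P[y₁, …, yₙ]^{GLₙ}`. -/
def ClassicalDickson (n : ℕ) : Subalgebra (ZMod p) (Poly p n) :=
  ⨅ g : GL (Fin n) (ZMod p), AlgHom.equalizer (polyAct p g.1) (AlgHom.id _ _)

/-- The algebra of reduced powers, realized as an algebra of operations on the polynomial algebras
`P[y₁, …, yₙ]`, `n ≥ 0`, on which it is faithfully represented. For `p = 2` it is the mod `2`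
Steenrod algebra, generated by the `Sqᵏ`. -/
abbrev ReducedPowerAlgebra : Type :=
  OperationAlgebra (ZMod p) (Poly p) (Set.range (polyPower p))

instance (n : ℕ) : Module (ReducedPowerAlgebra p) (Poly p n) :=
  OperationAlgebra.module _ n

theorem mem_classicalDickson {n : ℕ} {f : Poly p n} :
    f ∈ ClassicalDickson p n ↔ ∀ g : GL (Fin n) (ZMod p), polyAct p g.1 f = f := by
  simp [ClassicalDickson, Algebra.mem_iInf]

theorem totalPower_polyAct {n : ℕ} (g : Matrix (Fin n) (Fin n) (ZMod p)) (f : Poly p n) :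
    totalPower p n (polyAct p g f) =
      Polynomial.mapAlgHom (polyAct p g) (totalPower p n f) := by
  have key : (totalPower p n).comp (polyAct p g) =
      (Polynomial.mapAlgHom (polyAct p g)).comp (totalPower p n) := by
    refine MvPolynomial.algHom_ext fun j => ?_
    have hfrob : (∑ i, g i j • (MvPolynomial.X i : Poly p n)) ^ p =
        ∑ i, g i j • (MvPolynomial.X i : Poly p n) ^ p := by
      rw [sum_pow_char]
      refine Finset.sum_congr rfl fun i _ => ?_
      rw [smul_pow, ZMod.pow_card]
    simp only [AlgHom.comp_apply, polyAct, totalPower, MvPolynomial.aeval_X, map_sum, map_smul,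
      map_add, map_mul, map_pow, Polynomial.coe_mapAlgHom, Polynomial.map_C, Polynomial.map_X,
      RingHom.coe_coe]
    rw [← map_sum Polynomial.C, ← map_pow Polynomial.C, hfrob, map_sum, map_sum, Finset.sum_mul,
      ← Finset.sum_add_distrib]
    refine Finset.sum_congr rfl fun i _ => ?_
    rw [smul_add, ← Polynomial.smul_C, ← Polynomial.smul_C, smul_mul_assoc, map_pow]
  exact DFunLike.congr_fun key f

theorem polyPower_polyAct {n : ℕ} (k : ℕ) (g : Matrix (Fin n) (Fin n) (ZMod p)) (f : Poly p n) :
    polyPower p k n (polyAct p g f) = polyAct p g (polyPower p k n f) := by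
  change (totalPower p n (polyAct p g f)).coeff k = polyAct p g ((totalPower p n f).coeff k)
  rw [totalPower_polyAct]
  simp

theorem polyAug_polyPower {n : ℕ} (k : ℕ) (f : Poly p n) :
    polyAug p n (polyPower p k n f) = if k = 0 then polyAug p n f else 0 := by
  have key : (Polynomial.mapAlgHom (polyAug p n)).comp (totalPower p n) =
      (Algebra.ofId (ZMod p) (Polynomial (ZMod p))).comp (polyAug p n) := by
    refine MvPolynomial.algHom_ext fun j => ?_
    simp [totalPower, polyAug, (Fact.out : p.Prime).ne_zero]
  have h := congrArg (fun q => Polynomial.coeff q k) (DFunLike.congr_fun key f)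
  change polyAug p n ((totalPower p n f).coeff k) = _
  simpa [Algebra.ofId_apply, Polynomial.coeff_C] using h

/-- The augmentation ideal of the classical Dickson algebra, as a module over the algebra of
reduced powers. -/
def classicalAugmentationIdeal (n : ℕ) : Submodule (ReducedPowerAlgebra p) (Poly p n) where
  carrier := {f | f ∈ ClassicalDickson p n ∧ polyAug p n f = 0}
  add_mem' := fun {f g} hf hg => ⟨add_mem hf.1 hg.1, by rw [map_add, hf.2, hg.2, add_zero]⟩
  zero_mem' := ⟨zero_mem _, map_zero _⟩
  smul_mem' := fun a f hf => by
    refine OperationAlgebra.stable (n := n)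
      (Subalgebra.toSubmodule (ClassicalDickson p n) ⊓ LinearMap.ker (polyAug p n).toLinearMap)
      ?_ a f hf
    rintro _ ⟨k, rfl⟩ h ⟨h₁, h₂⟩
    refine ⟨(mem_classicalDickson p).2 fun g => ?_, ?_⟩
    · rw [← polyPower_polyAct, (mem_classicalDickson p).1 h₁ g]
    · have h₂' : polyAug p n h = 0 := h₂
      change polyAug p n (polyPower p k n h) = 0
      rw [polyAug_polyPower, h₂', ite_self]

/-! ### The algebra `E(x₁, …, xₙ) ⊗ P[y₁, …, yₙ]` for odd `p` -/

/-- The exterior algebra `E(x₁, …, xₙ)` over `ℤ/p`, with `xᵢ` the `i`-th standard basis vector. -/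
abbrev Ext (n : ℕ) : Type := ExteriorAlgebra (ZMod p) (Fin n → ZMod p)

/-- `E(x₁, …, xₙ) ⊗ P[y₁, …, yₙ]`, with `|xᵢ| = 1` and `|yᵢ| = 2`: for odd `p` this is the
cohomology algebra `H^*(BVⁿ; ℤ/p)`. The signs in the product of a graded tensor product are
trivial since the second factor is concentrated in even degrees. -/
abbrev Coh (n : ℕ) : Type := Ext p n ⊗[ZMod p] Poly p n

/-- The reduced power `Pᵏ` on `E ⊗ P`. By the Cartan formula, and since `P⁰ = 1` and `Pᵏ xᵢ = 0`
for `k ≥ 1`, it is the identity of `E` tensored with `Pᵏ` on `P`. -/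
def power (k n : ℕ) : Module.End (ZMod p) (Coh p n) :=
  LinearMap.lTensor (Ext p n) (polyPower p k n)

/-- The Bockstein on `E ⊗ P`, the derivation (with signs) with `β xᵢ = yᵢ` and `β yᵢ = 0`:
it is the sum over `i` of the signed derivation of `E` with `xⱼ ↦ δᵢⱼ`, tensored with
multiplication by `yᵢ`. -/
def bockstein (n : ℕ) : Module.End (ZMod p) (Coh p n) :=
  ∑ i, TensorProduct.map
    (CliffordAlgebra.contractLeft (Q := (0 : QuadraticForm (ZMod p) (Fin n → ZMod p)))
      (LinearMap.proj i))
    (LinearMap.mulLeft (ZMod p) (MvPolynomial.X i : Poly p n))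

/-- The linear substitution `xⱼ ↦ ∑ᵢ gᵢⱼ xᵢ`, `yⱼ ↦ ∑ᵢ gᵢⱼ yᵢ`. -/
def act {n : ℕ} (g : Matrix (Fin n) (Fin n) (ZMod p)) : Coh p n →ₐ[ZMod p] Coh p n :=
  Algebra.TensorProduct.map (ExteriorAlgebra.map g.mulVecLin) (polyAct p g)

/-- The augmentation `xᵢ ↦ 0`, `yᵢ ↦ 0`. -/
def aug (n : ℕ) : Coh p n →ₐ[ZMod p] ZMod p :=
  (Algebra.TensorProduct.lmul' (ZMod p)).comp
    (Algebra.TensorProduct.map ExteriorAlgebra.algebraMapInv (polyAug p n))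

/-- The extended Dickson algebra `Dₙ = (E(x₁, …, xₙ) ⊗ P[y₁, …, yₙ])^{GLₙ}`. -/
def ExtendedDickson (n : ℕ) : Subalgebra (ZMod p) (Coh p n) :=
  ⨅ g : GL (Fin n) (ZMod p), AlgHom.equalizer (act p g.1) (AlgHom.id _ _)

/-- The mod `p` Steenrod algebra for odd `p`, generated by `β` and the `Pᵏ`, realized as an algebra
of operations on the cohomology algebras `H^*(BVⁿ; ℤ/p)`, `n ≥ 0`, on which it is faithfully
represented. -/
abbrev SteenrodAlgebra : Type :=
  OperationAlgebra (ZMod p) (Coh p) (insert (bockstein p) (Set.range (power p)))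

instance (n : ℕ) : Module (SteenrodAlgebra p) (Coh p n) :=
  OperationAlgebra.module _ n

theorem mem_extendedDickson {n : ℕ} {f : Coh p n} :
    f ∈ ExtendedDickson p n ↔ ∀ g : GL (Fin n) (ZMod p), act p g.1 f = f := by
  simp [ExtendedDickson, Algebra.mem_iInf]

theorem power_act {n : ℕ} (k : ℕ) (g : Matrix (Fin n) (Fin n) (ZMod p)) (f : Coh p n) :
    power p k n (act p g f) = act p g (power p k n f) := by
  induction f using TensorProduct.induction_on with
  | zero => simp
  | tmul e f => simp [power, act, polyPower_polyAct]
  | add x y hx hy => simp only [map_add, hx, hy]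

theorem contractLeft_map {n : ℕ} (g : Matrix (Fin n) (Fin n) (ZMod p))
    (d : Module.Dual (ZMod p) (Fin n → ZMod p)) (e : Ext p n) :
    CliffordAlgebra.contractLeft (Q := (0 : QuadraticForm (ZMod p) (Fin n → ZMod p))) d
        (ExteriorAlgebra.map g.mulVecLin e) =
      ExteriorAlgebra.map g.mulVecLin
        (CliffordAlgebra.contractLeft (Q := (0 : QuadraticForm (ZMod p) (Fin n → ZMod p)))
          (d.comp g.mulVecLin) e) := by
  induction e using CliffordAlgebra.left_induction with
  | algebraMap r => simp
  | add x y hx hy => simp only [map_add, hx, hy]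
  | ι_mul x m hx =>
    have h1 : ExteriorAlgebra.map g.mulVecLin
        (CliffordAlgebra.ι (0 : QuadraticForm (ZMod p) (Fin n → ZMod p)) m) =
        CliffordAlgebra.ι (0 : QuadraticForm (ZMod p) (Fin n → ZMod p)) (g.mulVecLin m) :=
      ExteriorAlgebra.map_apply_ι _ _
    rw [map_mul, h1, CliffordAlgebra.contractLeft_ι_mul, hx, CliffordAlgebra.contractLeft_ι_mul,
      map_sub, map_smul, map_mul, h1]
    rfl

theorem bockstein_act {n : ℕ} (g : Matrix (Fin n) (Fin n) (ZMod p)) (f : Coh p n) :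
    bockstein p n (act p g f) = act p g (bockstein p n f) := by
  induction f using TensorProduct.induction_on with
  | zero => simp
  | add x y hx hy => simp only [map_add, hx, hy]
  | tmul e f =>
    have hd : ∀ i : Fin n, (LinearMap.proj i : Module.Dual (ZMod p) (Fin n → ZMod p)).comp
        g.mulVecLin = ∑ j, g i j • LinearMap.proj j := by
      intro i
      ext j
      simp [Pi.single_apply]
    simp only [bockstein, act, LinearMap.sum_apply, TensorProduct.map_tmul,
      Algebra.TensorProduct.map_tmul, contractLeft_map, hd, map_sum, map_smul,
      LinearMap.smul_apply, LinearMap.mulLeft_apply, map_mul, TensorProduct.sum_tmul]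
    rw [Finset.sum_comm]
    refine Finset.sum_congr rfl fun j _ => ?_
    simp only [polyAct, MvPolynomial.aeval_X, Finset.sum_mul, TensorProduct.tmul_sum,
      smul_mul_assoc, TensorProduct.tmul_smul, TensorProduct.smul_tmul']

theorem aug_power {n : ℕ} (k : ℕ) (f : Coh p n) :
    aug p n (power p k n f) = if k = 0 then aug p n f else 0 := by
  induction f using TensorProduct.induction_on with
  | zero => simp
  | tmul e f =>
    simp only [power, aug, LinearMap.lTensor_tmul, AlgHom.comp_apply,
      Algebra.TensorProduct.map_tmul, Algebra.TensorProduct.lmul'_apply_tmul, polyAug_polyPower]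
    split_ifs <;> simp
  | add x y hx hy =>
    simp only [map_add, hx, hy]
    split_ifs <;> simp

theorem aug_bockstein {n : ℕ} (f : Coh p n) : aug p n (bockstein p n f) = 0 := by
  induction f using TensorProduct.induction_on with
  | zero => simp
  | tmul e f => simp [bockstein, aug, polyAug]
  | add x y hx hy => simp only [map_add, hx, hy, add_zero]

/-- The augmentation ideal of the extended Dickson algebra `Dₙ`, as a module over the Steenrod
algebra. -/
def extendedAugmentationIdeal (n : ℕ) : Submodule (SteenrodAlgebra p) (Coh p n) where
  carrier := {f | f ∈ ExtendedDickson p n ∧ aug p n f = 0}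
  add_mem' := fun {f g} hf hg => ⟨add_mem hf.1 hg.1, by rw [map_add, hf.2, hg.2, add_zero]⟩
  zero_mem' := ⟨zero_mem _, map_zero _⟩
  smul_mem' := fun a f hf => by
    refine OperationAlgebra.stable (n := n)
      (Subalgebra.toSubmodule (ExtendedDickson p n) ⊓ LinearMap.ker (aug p n).toLinearMap)
      ?_ a f hf
    rintro _ (rfl | ⟨k, rfl⟩) h ⟨h₁, h₂⟩
    · refine ⟨(mem_extendedDickson p).2 fun g => ?_, aug_bockstein p h⟩
      rw [← bockstein_act, (mem_extendedDickson p).1 h₁ g]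
    · refine ⟨(mem_extendedDickson p).2 fun g => ?_, ?_⟩
      · rw [← power_act, (mem_extendedDickson p).1 h₁ g]
      · have h₂' : aug p n h = 0 := h₂
        change aug p n (power p k n h) = 0
        rw [aug_power, h₂', ite_self]

end Dickson

end

open scoped TensorProduct

noncomputable section

namespace Dickson

section

variable (p : ℕ) [Fact p.Prime]

/-! ### Reduced powers: Frobenius, top degree, primitive derivations -/

/-! Write e for the Euler class, the product of all nonzero linear forms. Every nonzero submodule
turns out to contain e^(p^k) for all large k, so two nonzero submodules always meet and no proper
splitting exists (`isIndecomposable_of_eventually_mem`).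

In the polynomial case let W be stable and contain a nonzero invariant f without constant term. The
operation P^d with d = deg f sends f to the p-th power of its leading form
(`polyPower_totalDegree`), which disposes of inhomogeneous elements. By Frobenius, the operations
can be carried out inside p^k-th powers, and so can the derivations D_i : yⱼ ↦ yⱼ^(p^i) with i ≥ 1,
which are iterated commutators of reduced powers.

The core is an induction on deg g for elements (e^a g)^(p^k) of W, with g a homogeneous invariant.
For 1 ≤ i < n, D_i kills e, while D_i g is a multiple of e. If some such D_i g is nonzero, it equals
e q with deg q < deg g. If all vanish, then g = e^b h^p: after multiplication by a power of e the
Euler derivation D_0 vanishes too, and the Moore determinant makes all partial derivatives zero.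
Since D_n e is a nonzero multiple of e², D_n raises the exponent of e to a multiple of p, and a p-th
root replaces g by h. The induction ends at a power of e. All divisibility by e rests on one
principle: an invariant that vanishes on the coordinate hyperplanes is divisible by e
(`eulerClass_dvd`).

For odd p and E ⊗ P, the Milnor operations Q_0, …, Q_{n-1} anticommute and square to zero. Applying
those that do not vanish gives a nonzero element killed by all of them; the Moore determinant again
shows that it is killed by every contraction, so it lies in P (`exists_one_tmul_mem`), and the
polynomial case applies. -/

theorem totalPower_X {n : ℕ} (j : Fin n) : totalPower p n (MvPolynomial.X j) =
    Polynomial.C (MvPolynomial.X j) + Polynomial.C (MvPolynomial.X j ^ p) * Polynomial.X := by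
  simp [totalPower]

theorem totalPower_X_pow {n : ℕ} (j : Fin n) (i : ℕ) :
    totalPower p n (MvPolynomial.X j ^ p ^ i) =
      Polynomial.C (MvPolynomial.X j ^ p ^ i) +
        Polynomial.C (MvPolynomial.X j ^ p ^ (i + 1)) * Polynomial.X ^ p ^ i := by
  rw [map_pow, totalPower_X, add_pow_char_pow, mul_pow, ← Polynomial.C_pow, ← Polynomial.C_pow,
    ← pow_mul, pow_succ' p i]

theorem polyPower_apply {k n : ℕ} (f : Poly p n) :
    polyPower p k n f = (totalPower p n f).coeff k := rfl

theorem polyPower_X_pow_mul {n : ℕ} (j : Fin n) (i : ℕ) (f : Poly p n) :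
    polyPower p (p ^ i) n (MvPolynomial.X j ^ p ^ i * f) =
      MvPolynomial.X j ^ p ^ i * polyPower p (p ^ i) n f +
        MvPolynomial.X j ^ p ^ (i + 1) * polyPower p 0 n f := by
  have h : (Polynomial.X ^ p ^ i * totalPower p n f).coeff (p ^ i) =
      (totalPower p n f).coeff 0 := by
    simpa using Polynomial.coeff_X_pow_mul (totalPower p n f) (p ^ i) 0
  rw [polyPower_apply, map_mul, totalPower_X_pow, add_mul, Polynomial.coeff_add, mul_assoc,
    Polynomial.coeff_C_mul, Polynomial.coeff_C_mul, h]
  rfl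

theorem polyPower_zero {n : ℕ} (f : Poly p n) : polyPower p 0 n f = f := by
  have h : (Polynomial.constantCoeff.comp (totalPower p n).toRingHom) = RingHom.id _ := by
    refine MvPolynomial.ringHom_ext (fun r => ?_) fun j => ?_
    · simp [← MvPolynomial.algebraMap_eq]
    · simp [totalPower_X]
  simpa [polyPower_apply, Polynomial.constantCoeff_apply] using DFunLike.congr_fun h f

/-- The p-th power of a polynomial in T has the p-th powers of the old coefficients, at exponents
multiplied by p. Through this, operations act inside p^k-th powers. -/
theorem polyPower_pow_char {n : ℕ} (j k : ℕ) (h : Poly p n) :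
    polyPower p (j * p ^ k) n (h ^ p ^ k) = polyPower p j n h ^ p ^ k := by
  induction k generalizing h j with
  | zero => simp
  | succ k ih =>
    have e : polyPower p (j * p) n (h ^ p) = polyPower p j n h ^ p := by
      rw [polyPower_apply, map_pow, ← Polynomial.map_frobenius_expand, Polynomial.coeff_map,
        Polynomial.coeff_expand_mul (Fact.out : p.Prime).pos]
      rfl
    rw [pow_succ', pow_mul h, ← mul_assoc, ih, e, ← pow_mul]

/-- Each variable contributes T-degree at most one, with leading coefficient its p-th power.
Allowing `d` above the degree gives the degree bound needed for products in the same induction. -/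
theorem coeff_totalPower_prod {n : ℕ} (s : Fin n →₀ ℕ) (d : ℕ) (hd : s.degree ≤ d) :
    (totalPower p n (MvPolynomial.monomial s 1)).coeff d =
      if s.degree = d then MvPolynomial.monomial s 1 ^ p else 0 := by
  induction s using Finsupp.induction_linear generalizing d with
  | zero =>
    rw [show (MvPolynomial.monomial (0 : Fin n →₀ ℕ) (1 : ZMod p)) = 1 from rfl, map_one,
      Polynomial.coeff_one]
    simp [eq_comm]
  | add f g hf hg =>
    rw [map_add] at hd
    have hfn : (totalPower p n (MvPolynomial.monomial f 1)).natDegree ≤ f.degree := by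
      refine Polynomial.natDegree_le_iff_coeff_eq_zero.2 fun N hN => ?_
      rw [hf N hN.le, if_neg hN.ne]
    have hgn : (totalPower p n (MvPolynomial.monomial g 1)).natDegree ≤ g.degree := by
      refine Polynomial.natDegree_le_iff_coeff_eq_zero.2 fun N hN => ?_
      rw [hg N hN.le, if_neg hN.ne]
    have hm : (MvPolynomial.monomial (f + g) (1 : ZMod p)) =
        MvPolynomial.monomial f 1 * MvPolynomial.monomial g 1 := by
      rw [MvPolynomial.monomial_mul, one_mul]
    rw [hm, map_mul, map_add]
    split_ifs with h
    · rw [← h, Polynomial.coeff_mul_add_eq_of_natDegree_le hfn hgn, hf _ le_rfl, hg _ le_rfl,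
        if_pos rfl, if_pos rfl, mul_pow]
    · refine Polynomial.coeff_eq_zero_of_natDegree_lt (lt_of_le_of_lt
        (Polynomial.natDegree_mul_le_of_le hfn hgn) (lt_of_le_of_ne hd h))
  | single j a =>
    have hX : totalPower p n (MvPolynomial.X j) =
        Polynomial.C (MvPolynomial.X j ^ p) * Polynomial.X + Polynomial.C (MvPolynomial.X j) := by
      rw [totalPower_X, add_comm]
    have hm : (MvPolynomial.monomial (Finsupp.single j a) (1 : ZMod p)) =
        MvPolynomial.X j ^ a := by
      rw [MvPolynomial.X_pow_eq_monomial]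
    have h1 : (totalPower p n (MvPolynomial.X j)).natDegree ≤ 1 := by
      rw [hX]; exact Polynomial.natDegree_linear_le
    rw [Finsupp.degree_single] at hd ⊢
    rw [hm, map_pow]
    split_ifs with h
    · have := Polynomial.coeff_pow_of_natDegree_le (m := a) h1
      rw [← h]
      rw [mul_one] at this
      rw [this, totalPower_X, Polynomial.coeff_add, Polynomial.coeff_C_mul,
        Polynomial.coeff_X_one, Polynomial.coeff_C_of_ne_zero one_ne_zero, zero_add, mul_one,
        ← pow_mul, ← pow_mul, mul_comm]
    · refine Polynomial.coeff_eq_zero_of_natDegree_lt (lt_of_le_of_lt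
        (Polynomial.natDegree_pow_le_of_le a h1) ?_)
      rw [mul_one]
      exact lt_of_le_of_ne hd h

/-- The top reduced power of an inhomogeneous polynomial is the `p`-th power of its leading form. -/
theorem polyPower_totalDegree {n : ℕ} (f : Poly p n) :
    polyPower p f.totalDegree n f =
      MvPolynomial.homogeneousComponent f.totalDegree f ^ p := by
  set d := f.totalDegree with hd
  have h1 : ∀ s ∈ f.support, polyPower p d n (MvPolynomial.monomial s (f.coeff s)) =
      (if s.degree = d then MvPolynomial.monomial s (f.coeff s) else 0) ^ p := by
    intro s hs
    have hsd : s.degree ≤ d := by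
      rw [hd]
      exact MvPolynomial.le_totalDegree hs
    have hm : MvPolynomial.monomial s (f.coeff s) =
        f.coeff s • (MvPolynomial.monomial s (1 : ZMod p)) := by
      simp [MvPolynomial.smul_monomial]
    rw [hm, map_smul, polyPower_apply, coeff_totalPower_prod p s d hsd]
    split_ifs with h
    · rw [smul_pow, ZMod.pow_card]
    · simp [(Fact.out : p.Prime).ne_zero]
  conv_lhs => rw [f.as_sum]
  rw [map_sum, Finset.sum_congr rfl h1, ← sum_pow_char, MvPolynomial.homogeneousComponent_apply,
    Finset.sum_filter]

/-- The derivation `yⱼ ↦ yⱼ^(pⁱ)`. For `i ≥ 1` it is the Milnor primitive in degree `pⁱ - 1`;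
for `i = 0` it is the Euler derivation. -/
def prim (n i : ℕ) : Derivation (ZMod p) (Poly p n) (Poly p n) :=
  MvPolynomial.mkDerivation (ZMod p) fun j => MvPolynomial.X j ^ p ^ i

@[simp] theorem prim_X {n : ℕ} (i : ℕ) (j : Fin n) :
    prim p n i (MvPolynomial.X j) = MvPolynomial.X j ^ p ^ i := by
  simp [prim]

theorem prim_pow_char {n : ℕ} (i : ℕ) (f : Poly p n) : prim p n i (f ^ p) = 0 := by
  rw [Derivation.leibniz_pow, ← Nat.cast_smul_eq_nsmul (Poly p n) p]
  simp

/-- A derivation applied to the coefficients of a polynomial. -/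
def coeffwise {n : ℕ} (D : Derivation (ZMod p) (Poly p n) (Poly p n))
    (q : Polynomial (Poly p n)) : Polynomial (Poly p n) :=
  q.sum fun k a => Polynomial.monomial k (D a)

theorem coeff_coeffwise {n : ℕ} (D : Derivation (ZMod p) (Poly p n) (Poly p n))
    (q : Polynomial (Poly p n)) (k : ℕ) : (coeffwise p D q).coeff k = D (q.coeff k) := by
  rw [coeffwise, Polynomial.sum, Polynomial.finsetSum_coeff]
  simp +contextual [Polynomial.coeff_monomial]

theorem coeffwise_add {n : ℕ} (D : Derivation (ZMod p) (Poly p n) (Poly p n))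
    (q r : Polynomial (Poly p n)) : coeffwise p D (q + r) = coeffwise p D q + coeffwise p D r := by
  ext1 k
  simp [coeff_coeffwise]

theorem coeffwise_mul {n : ℕ} (D : Derivation (ZMod p) (Poly p n) (Poly p n))
    (q r : Polynomial (Poly p n)) :
    coeffwise p D (q * r) = q * coeffwise p D r + r * coeffwise p D q := by
  rw [mul_comm r]
  ext1 k
  simp only [coeff_coeffwise, Polynomial.coeff_add, Polynomial.coeff_mul, map_sum,
    Derivation.leibniz, smul_eq_mul, Finset.sum_add_distrib]
  exact congrArg _ (Finset.sum_congr rfl fun x _ => mul_comm _ _)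

/-- Generating function of the commutators of reduced powers with `prim`. Both sides obey the
Leibniz rule along `totalPower`, so only the generators need a check. -/
theorem totalPower_prim {n : ℕ} (i : ℕ) (f : Poly p n) :
    totalPower p n (prim p n i f) = coeffwise p (prim p n i) (totalPower p n f) +
      Polynomial.X ^ p ^ i * coeffwise p (prim p n (i + 1)) (totalPower p n f) := by
  induction f using MvPolynomial.induction_on with
  | C a =>
    have h1 : ∀ i, coeffwise p (prim p n i) (totalPower p n (MvPolynomial.C a)) = 0 := by
      intro i
      ext1 k
      rw [coeff_coeffwise, ← MvPolynomial.algebraMap_eq, AlgHom.commutes,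
        IsScalarTower.algebraMap_apply (ZMod p) (Poly p n) (Polynomial (Poly p n)),
        Polynomial.algebraMap_eq, Polynomial.coeff_C]
      split_ifs <;> simp
    rw [h1, h1, ← MvPolynomial.algebraMap_eq, Derivation.map_algebraMap]
    simp
  | add f g hf hg =>
    rw [map_add, map_add, hf, hg, map_add, coeffwise_add, coeffwise_add]
    ring
  | mul_X f j hf =>
    have h1 : ∀ i, coeffwise p (prim p n i) (totalPower p n (MvPolynomial.X j)) =
        Polynomial.C (MvPolynomial.X j ^ p ^ i) := by
      intro i
      ext1 k
      rw [coeff_coeffwise, totalPower_X]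
      rcases k with _ | _ | k
      · simp [-map_pow]
      · simp [-map_pow, Polynomial.coeff_C]
      · simp [-map_pow]
    rw [Derivation.leibniz, smul_eq_mul, smul_eq_mul, map_add, map_mul, map_mul, map_mul, prim_X,
      coeffwise_mul, coeffwise_mul, h1, h1, totalPower_X_pow, hf]
    ring

theorem polyPower_one {n : ℕ} (f : Poly p n) : polyPower p 1 n f = prim p n 1 f := by
  have h0 : ∀ f : Poly p n, (totalPower p n f).coeff 0 = f := polyPower_zero p
  induction f using MvPolynomial.induction_on with
  | C a =>
    rw [polyPower_apply, ← MvPolynomial.algebraMap_eq, AlgHom.commutes,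
      IsScalarTower.algebraMap_apply (ZMod p) (Poly p n) (Polynomial (Poly p n)),
      Polynomial.algebraMap_eq, Polynomial.coeff_C]
    simp
  | add f g hf hg => rw [map_add, hf, hg, map_add]
  | mul_X f j hf =>
    rw [polyPower_apply] at hf
    rw [polyPower_apply, map_mul, Derivation.leibniz, prim_X, ← hf, totalPower_X, mul_add,
      ← mul_assoc, Polynomial.coeff_add, Polynomial.coeff_mul_C, Polynomial.coeff_mul_X,
      Polynomial.coeff_mul_C, h0, pow_one, smul_eq_mul, smul_eq_mul]
    ring

/-- Milnor's recursion, read off at T^(p^i). With `polyPower_one` as its start, it generates all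
`prim i`, i ≥ 1, from reduced powers. -/
theorem prim_succ {n : ℕ} (i : ℕ) (f : Poly p n) :
    prim p n (i + 1) f =
      polyPower p (p ^ i) n (prim p n i f) - prim p n i (polyPower p (p ^ i) n f) := by
  have h : (Polynomial.X ^ p ^ i * coeffwise p (prim p n (i + 1)) (totalPower p n f)).coeff
      (p ^ i) = prim p n (i + 1) f := by
    rw [← polyPower_zero p f, polyPower_apply, ← coeff_coeffwise, ← polyPower_apply,
      polyPower_zero]
    simpa using Polynomial.coeff_X_pow_mul
      (coeffwise p (prim p n (i + 1)) (totalPower p n f)) (p ^ i) 0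
  rw [polyPower_apply, totalPower_prim, Polynomial.coeff_add, h, coeff_coeffwise,
    ← polyPower_apply]
  ring

/-- A subspace of the polynomial algebra stable under the reduced powers. -/
def PowerStable {n : ℕ} (W : Submodule (ZMod p) (Poly p n)) : Prop :=
  ∀ k, ∀ f ∈ W, polyPower p k n f ∈ W

variable {p}

theorem PowerStable.polyPower_pow_mem {n : ℕ} {W : Submodule (ZMod p) (Poly p n)}
    (hW : PowerStable p W) {h : Poly p n} {k : ℕ} (hh : h ^ p ^ k ∈ W) (j : ℕ) :
    polyPower p j n h ^ p ^ k ∈ W := by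
  rw [← polyPower_pow_char]
  exact hW _ _ hh

/-- Additivity of Frobenius turns the commutator inside the p^k-th power into a difference of
members of W. The recursion starts at P¹; the Euler derivation `prim 0` is not available, since W
need not be graded. -/
theorem PowerStable.prim_pow_mem {n : ℕ} {W : Submodule (ZMod p) (Poly p n)}
    (hW : PowerStable p W) {h : Poly p n} {k : ℕ} (hh : h ^ p ^ k ∈ W) {i : ℕ} (hi : 1 ≤ i) :
    prim p n i h ^ p ^ k ∈ W := by
  induction i, hi using Nat.le_induction generalizing h with
  | base =>
    rw [← polyPower_one]
    exact hW.polyPower_pow_mem hh 1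
  | succ i hi ih =>
    rw [prim_succ, sub_pow_char_pow]
    exact W.sub_mem (hW.polyPower_pow_mem (ih hh) _) (ih (hW.polyPower_pow_mem hh _))

end

section

variable (p : ℕ) [Fact p.Prime]

/-! ### Linear forms and the Euler class -/

/-- The linear form `∑ⱼ vⱼ yⱼ`. -/
def linForm {n : ℕ} (v : Fin n → ZMod p) : Poly p n := ∑ j, v j • MvPolynomial.X j

theorem linForm_smul {n : ℕ} (a : ZMod p) (v : Fin n → ZMod p) :
    linForm p (a • v) = a • linForm p v := by
  simp [linForm, Finset.smul_sum, smul_smul]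

theorem linForm_add {n : ℕ} (v w : Fin n → ZMod p) :
    linForm p (v + w) = linForm p v + linForm p w := by
  simp [linForm, add_smul, Finset.sum_add_distrib]

theorem linForm_single {n : ℕ} (k : Fin n) (a : ZMod p) :
    linForm p (Pi.single k a) = a • MvPolynomial.X k := by
  rw [linForm, Finset.sum_eq_single k]
  · simp
  · intro j _ hj
    simp [hj]
  · simp

theorem coeff_linForm {n : ℕ} (v : Fin n → ZMod p) (j : Fin n) :
    (linForm p v).coeff (Finsupp.single j 1) = v j := by
  rw [linForm, MvPolynomial.coeff_sum, Finset.sum_eq_single j]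
  · simp
  · intro i _ hi
    simp [MvPolynomial.coeff_X, Finsupp.single_left_inj, hi]
  · simp

theorem linForm_injective {n : ℕ} : Function.Injective (linForm p (n := n)) := fun v w h => by
  ext j
  rw [← coeff_linForm p v, h, coeff_linForm]

theorem linForm_ne_zero {n : ℕ} {v : Fin n → ZMod p} (hv : v ≠ 0) : linForm p v ≠ 0 := fun h =>
  hv (linForm_injective p (h.trans (by simp [linForm])))

theorem isHomogeneous_linForm {n : ℕ} (v : Fin n → ZMod p) : (linForm p v).IsHomogeneous 1 := by
  refine MvPolynomial.IsHomogeneous.sum _ _ _ fun j _ => ?_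
  rw [MvPolynomial.smul_eq_C_mul]
  exact MvPolynomial.isHomogeneous_C_mul_X _ _

theorem linForm_pow {n : ℕ} (v : Fin n → ZMod p) (i : ℕ) :
    linForm p v ^ p ^ i = ∑ j, v j • MvPolynomial.X j ^ p ^ i := by
  rw [linForm, sum_pow_char_pow]
  exact Finset.sum_congr rfl fun j _ => by rw [smul_pow, ZMod.pow_card_pow]

theorem prim_linForm {n : ℕ} (i : ℕ) (v : Fin n → ZMod p) :
    prim p n i (linForm p v) = linForm p v ^ p ^ i := by
  rw [linForm_pow, linForm, map_sum]
  exact Finset.sum_congr rfl fun j _ => by rw [Derivation.map_smul, prim_X]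

/-! ### Linear substitutions and primality of linear forms -/

theorem polyAct_X {n : ℕ} (g : Matrix (Fin n) (Fin n) (ZMod p)) (j : Fin n) :
    polyAct p g (MvPolynomial.X j) = linForm p (g.col j) := by
  simp [polyAct, linForm]

theorem polyAct_linForm {n : ℕ} (g : Matrix (Fin n) (Fin n) (ZMod p)) (v : Fin n → ZMod p) :
    polyAct p g (linForm p v) = linForm p (g.mulVec v) := by
  simp only [linForm, map_sum, map_smul, polyAct, MvPolynomial.aeval_X, Matrix.mulVec, dotProduct,
    Finset.smul_sum, Finset.sum_smul, smul_smul]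
  rw [Finset.sum_comm]
  simp [mul_comm]

theorem polyAct_mul {n : ℕ} (g h : Matrix (Fin n) (Fin n) (ZMod p)) (f : Poly p n) :
    polyAct p (g * h) f = polyAct p g (polyAct p h f) := by
  have : polyAct p (g * h) = (polyAct p g).comp (polyAct p h) := by
    refine MvPolynomial.algHom_ext fun j => ?_
    rw [AlgHom.comp_apply, polyAct_X, polyAct_X, polyAct_linForm]
    rfl
  rw [this, AlgHom.comp_apply]

theorem polyAct_one {n : ℕ} (f : Poly p n) : polyAct p 1 f = f := by
  have : polyAct p (1 : Matrix (Fin n) (Fin n) (ZMod p)) = AlgHom.id _ _ := by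
    refine MvPolynomial.algHom_ext fun j => ?_
    simp [polyAct, Matrix.one_apply]
  rw [this, AlgHom.id_apply]

/-- Linear substitution by an invertible matrix as an automorphism. -/
def polyActEquiv {n : ℕ} (g : GL (Fin n) (ZMod p)) : Poly p n ≃ₐ[ZMod p] Poly p n :=
  AlgEquiv.ofAlgHom (polyAct p g.1) (polyAct p (g⁻¹).1)
    (AlgHom.ext fun f => by
      rw [AlgHom.comp_apply, ← polyAct_mul, ← Units.val_mul, mul_inv_cancel, Units.val_one,
        polyAct_one, AlgHom.id_apply])
    (AlgHom.ext fun f => by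
      rw [AlgHom.comp_apply, ← polyAct_mul, ← Units.val_mul, inv_mul_cancel, Units.val_one,
        polyAct_one, AlgHom.id_apply])

theorem polyActEquiv_apply {n : ℕ} (g : GL (Fin n) (ZMod p)) (f : Poly p n) :
    polyActEquiv p g f = polyAct p g.1 f := rfl

/-- A nonzero vector is a column of an invertible matrix. -/
theorem exists_GL_col_eq {n : ℕ} {v : Fin n → ZMod p} (hv : v ≠ 0) :
    ∃ (g : GL (Fin n) (ZMod p)) (k : Fin n), g.1.col k = v := by
  obtain ⟨k, hk⟩ := Function.ne_iff.1 hv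
  have hdet : (Matrix.updateCol (1 : Matrix (Fin n) (Fin n) (ZMod p)) k v).det ≠ 0 := by
    rw [← Matrix.cramer_apply, Matrix.cramer_one]
    exact hk
  refine ⟨Matrix.GeneralLinearGroup.mkOfDetNeZero _ hdet, k, ?_⟩
  ext j
  change Matrix.updateCol (1 : Matrix (Fin n) (Fin n) (ZMod p)) k v j k = v j
  simp

theorem prime_linForm {n : ℕ} {v : Fin n → ZMod p} (hv : v ≠ 0) : Prime (linForm p v) := by
  obtain ⟨g, k, rfl⟩ := exists_GL_col_eq p hv
  rw [← polyAct_X, ← polyActEquiv_apply, MulEquiv.prime_iff]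
  exact MvPolynomial.X_prime

theorem exists_smul_of_linForm_dvd {n : ℕ} {v w : Fin n → ZMod p} (hv : v ≠ 0)
    (h : linForm p v ∣ linForm p w) : ∃ a : ZMod p, a • v = w := by
  obtain ⟨g, k, rfl⟩ := exists_GL_col_eq p hv
  set u := (g⁻¹).1.mulVec w with hu
  have hw : g.1.mulVec u = w := by
    rw [hu, Matrix.mulVec_mulVec, ← Units.val_mul, mul_inv_cancel, Units.val_one,
      Matrix.one_mulVec]
  have hdvd : MvPolynomial.X k ∣ linForm p u := by
    rw [← map_dvd_iff (polyActEquiv p g), polyActEquiv_apply, polyActEquiv_apply, polyAct_X,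
      polyAct_linForm, hw]
    exact h
  have hu' : u = Pi.single k (u k) := by
    ext j
    by_cases hj : j = k
    · subst hj; simp
    · obtain ⟨q, hq⟩ := hdvd
      rw [Pi.single_eq_of_ne hj, ← coeff_linForm p u, hq, MvPolynomial.coeff_X_mul', if_neg]
      simpa using Ne.symm hj
  refine ⟨u k, ?_⟩
  rw [← hw, hu']
  ext j
  simp [mul_comm]

variable {p}

/-! ### Divisibility of invariants by linear forms -/

theorem coeff_polyAct_diagonal {n : ℕ} (d : Fin n → ZMod p) (f : Poly p n) (s : Fin n →₀ ℕ) :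
    (polyAct p (Matrix.diagonal d) f).coeff s = (∏ j, d j ^ s j) * f.coeff s := by
  have hX : ∀ j, ∑ i, Matrix.diagonal d i j • (MvPolynomial.X i : Poly p n) =
      MvPolynomial.C (d j) * MvPolynomial.X j := by
    intro j
    rw [Finset.sum_eq_single j]
    · simp [MvPolynomial.smul_eq_C_mul]
    · intro i _ hi
      simp [Matrix.diagonal_apply_ne _ hi]
    · simp
  induction f using MvPolynomial.induction_on' with
  | add f g hf hg => rw [map_add, MvPolynomial.coeff_add, hf, hg, MvPolynomial.coeff_add, mul_add]
  | monomial t a =>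
    have : polyAct p (Matrix.diagonal d) (MvPolynomial.monomial t a) =
        MvPolynomial.C (∏ j, d j ^ t j) * MvPolynomial.monomial t a := by
      rw [polyAct, MvPolynomial.aeval_monomial, Finsupp.prod_fintype _ _ (fun _ => pow_zero _)]
      simp only [hX, mul_pow, Finset.prod_mul_distrib]
      rw [MvPolynomial.monomial_eq, Finsupp.prod_fintype _ _ (fun _ => pow_zero _),
        MvPolynomial.algebraMap_eq, map_prod]
      simp only [map_pow]
      ring
    rw [this, MvPolynomial.coeff_C_mul, MvPolynomial.coeff_monomial]
    split_ifs with h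
    · rw [h]
    · simp

/-- Scaling yₖ by a unit a multiplies a monomial by a to its exponent at k. Invariance makes every
such exponent a multiple of p - 1, and it is positive because yₖ divides f. -/
theorem X_pow_dvd_of_mem {n : ℕ} {f : Poly p n} (hf : f ∈ ClassicalDickson p n) {k : Fin n}
    (hk : MvPolynomial.X k ∣ f) : MvPolynomial.X k ^ (p - 1) ∣ f := by
  rw [f.as_sum]
  refine Finset.dvd_sum fun s hs => ?_
  have hs0 : f.coeff s ≠ 0 := MvPolynomial.mem_support_iff.1 hs
  have h1 : s k ≠ 0 := by
    obtain ⟨q, rfl⟩ := hk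
    rw [MvPolynomial.coeff_X_mul'] at hs0
    have := (ite_ne_right_iff.1 hs0).1
    simpa using this
  have h2 : p - 1 ∣ s k := by
    have := (FiniteField.forall_pow_eq_one_iff (ZMod p) (s k)).1 fun a => by
      have hdet : (Matrix.diagonal (Function.update (1 : Fin n → ZMod p) k a)).det ≠ 0 := by
        rw [Matrix.det_diagonal, Finset.prod_update_of_mem (Finset.mem_univ k)]
        simp
      have h := congrArg (MvPolynomial.coeff s) ((mem_classicalDickson p).1 hf
        (Matrix.GeneralLinearGroup.mkOfDetNeZero _ hdet))
      have h' : (∏ j, (Function.update (1 : Fin n → ZMod p) k a) j ^ s j) * f.coeff s =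
          f.coeff s := by
        rw [← coeff_polyAct_diagonal]; exact h
      have h3 : ∏ j, (Function.update (1 : Fin n → ZMod p) k a) j ^ s j = (a : ZMod p) ^ s k := by
        rw [Finset.prod_eq_single k]
        · simp
        · intro j _ hj
          simp [Function.update_of_ne hj]
        · simp
      rw [h3] at h'
      ext
      rw [Units.val_pow_eq_pow_val, Units.val_one]
      exact mul_right_cancel₀ hs0 (h'.trans (one_mul _).symm)
    rwa [ZMod.card] at this
  rw [MvPolynomial.X_pow_eq_monomial, MvPolynomial.monomial_dvd_monomial]
  refine ⟨Or.inr ?_, one_dvd _⟩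
  rw [Finsupp.single_le_iff]
  exact Nat.le_of_dvd (Nat.pos_of_ne_zero h1) h2

variable (p)

/-- The Euler class, the product of all nonzero linear forms; up to sign it is the Dickson
invariant of highest degree `pⁿ - 1`. -/
def eulerClass (n : ℕ) : Poly p n := ∏ v : {v : Fin n → ZMod p // v ≠ 0}, linForm p v.1

theorem eulerClass_ne_zero (n : ℕ) : eulerClass p n ≠ 0 :=
  Finset.prod_ne_zero_iff.2 fun v _ => linForm_ne_zero p v.2

/-- An invertible matrix permutes the nonzero vectors. -/
def nonzeroPerm {n : ℕ} (g : GL (Fin n) (ZMod p)) : Equiv.Perm {v : Fin n → ZMod p // v ≠ 0} where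
  toFun v := ⟨g.1.mulVec v.1, fun h => v.2 (by
    have := congrArg (g⁻¹).1.mulVec h
    rwa [Matrix.mulVec_mulVec, ← Units.val_mul, inv_mul_cancel, Units.val_one, Matrix.one_mulVec,
      Matrix.mulVec_zero] at this)⟩
  invFun v := ⟨(g⁻¹).1.mulVec v.1, fun h => v.2 (by
    have := congrArg g.1.mulVec h
    rwa [Matrix.mulVec_mulVec, ← Units.val_mul, mul_inv_cancel, Units.val_one, Matrix.one_mulVec,
      Matrix.mulVec_zero] at this)⟩
  left_inv v := by
    ext1
    simp only [Matrix.mulVec_mulVec, ← Units.val_mul, inv_mul_cancel, Units.val_one,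
      Matrix.one_mulVec]
  right_inv v := by
    ext1
    simp only [Matrix.mulVec_mulVec, ← Units.val_mul, mul_inv_cancel, Units.val_one,
      Matrix.one_mulVec]

theorem eulerClass_mem (n : ℕ) : eulerClass p n ∈ ClassicalDickson p n := by
  refine (mem_classicalDickson p).2 fun g => ?_
  rw [eulerClass, map_prod]
  simp only [polyAct_linForm]
  exact Equiv.prod_comp (nonzeroPerm p g) fun v => linForm p v.1

theorem card_nonzero (n : ℕ) : Fintype.card {v : Fin n → ZMod p // v ≠ 0} = p ^ n - 1 := by
  rw [Fintype.card_subtype_compl, Fintype.card_subtype_eq]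
  simp

theorem isHomogeneous_eulerClass (n : ℕ) : (eulerClass p n).IsHomogeneous (p ^ n - 1) := by
  have := MvPolynomial.IsHomogeneous.prod Finset.univ
    (fun v : {v : Fin n → ZMod p // v ≠ 0} => linForm p v.1) (fun _ => 1)
    (fun v _ => isHomogeneous_linForm p v.1)
  simpa [eulerClass, card_nonzero] using this

theorem X_dvd_eulerClass {n : ℕ} (k : Fin n) : MvPolynomial.X k ∣ eulerClass p n := by
  have hk : (Pi.single k 1 : Fin n → ZMod p) ≠ 0 := by simp
  have := Finset.dvd_prod_of_mem (fun v : {v : Fin n → ZMod p // v ≠ 0} => linForm p v.1)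
    (Finset.mem_univ ⟨_, hk⟩)
  simp only [linForm_single, one_smul] at this
  exact this

variable {p}

theorem linForm_pow_dvd_of_mem {n : ℕ} {f : Poly p n} (hf : f ∈ ClassicalDickson p n)
    (hX : ∀ k, MvPolynomial.X k ∣ f) {v : Fin n → ZMod p} (hv : v ≠ 0) :
    linForm p v ^ (p - 1) ∣ f := by
  obtain ⟨g, k, rfl⟩ := exists_GL_col_eq p hv
  have := map_dvd (polyAct p g.1) (X_pow_dvd_of_mem hf (hX k))
  rwa [map_pow, polyAct_X, (mem_classicalDickson p).1 hf] at this

/-- An invariant that vanishes on all coordinate hyperplanes is divisible by the Euler class. -/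
theorem eulerClass_dvd {n : ℕ} {f : Poly p n} (hf : f ∈ ClassicalDickson p n)
    (hX : ∀ k, MvPolynomial.X k ∣ f) : eulerClass p n ∣ f := by
  classical
  let π : {v : Fin n → ZMod p // v ≠ 0} → Projectivization (ZMod p) (Fin n → ZMod p) :=
    fun v => Projectivization.mk _ v.1 v.2
  have : Fintype (Projectivization (ZMod p) (Fin n → ZMod p)) := Fintype.ofFinite _
  rw [eulerClass, ← Fintype.prod_fiberwise π]
  refine Fintype.prod_dvd_of_isRelPrime (fun P Q hPQ => ?_) fun P => ?_
  -- Forms on distinct lines are nonassociate primes, so each line can be treated separately.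
  · refine IsRelPrime.prod_left fun v _ => IsRelPrime.prod_right fun w _ => ?_
    rw [(prime_linForm p v.1.2).irreducible.isRelPrime_iff_not_dvd]
    intro h
    obtain ⟨a, ha⟩ := exists_smul_of_linForm_dvd p v.1.2 h
    refine hPQ ?_
    rw [← v.2, ← w.2]
    exact ((Projectivization.mk_eq_mk_iff' _ _ _ _ _).2 ⟨a, ha⟩).symm
  · have h1 : ∀ v : {v // π v = P}, ∃ a : (ZMod p)ˣ, (a : ZMod p) • P.rep = v.1.1 := by
      intro v
      have h : π v.1 = Projectivization.mk _ P.rep P.rep_nonzero := v.2.trans P.mk_rep.symm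
      obtain ⟨a, ha⟩ := (Projectivization.mk_eq_mk_iff _ _ _ _ _).1 h
      exact ⟨a, ha⟩
    choose a ha using h1
    -- The forms on one line are unit multiples of a single form, at most p - 1 in number, and the
    -- (p - 1)-st power of that form divides f.
    have hcard : Fintype.card {v // π v = P} ≤ p - 1 := by
      rw [← ZMod.card_units p]
      refine Fintype.card_le_of_injective a fun v w h => Subtype.ext (Subtype.ext ?_)
      rw [← ha v, h, ha w]
    refine dvd_trans ?_ (linForm_pow_dvd_of_mem hf hX P.rep_nonzero)
    refine dvd_trans ?_ (pow_dvd_pow _ hcard)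
    rw [← Finset.card_univ, ← Finset.prod_const]
    refine Finset.prod_dvd_prod_of_dvd _ _ fun v _ => ?_
    rw [← ha v, linForm_smul]
    refine ⟨((a v)⁻¹ : (ZMod p)ˣ).1 • 1, ?_⟩
    rw [smul_mul_smul_comm, ← Units.val_mul]
    simp

end

variable {p : ℕ} [Fact p.Prime]

/-! ### The primitive derivations on invariants -/

theorem prim_eq_sum {n : ℕ} (i : ℕ) (f : Poly p n) :
    prim p n i f = ∑ j, MvPolynomial.X j ^ p ^ i * MvPolynomial.pderiv j f := by
  induction f using MvPolynomial.induction_on with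
  | C a => simp [← MvPolynomial.algebraMap_eq]
  | add f g hf hg => simp only [map_add, hf, hg, mul_add, Finset.sum_add_distrib]
  | mul_X f l hf =>
    have h : ∑ j, MvPolynomial.X j ^ p ^ i * MvPolynomial.pderiv j (MvPolynomial.X l : Poly p n) =
        MvPolynomial.X l ^ p ^ i := by
      rw [Finset.sum_eq_single l]
      · simp
      · intro j _ hj
        simp [MvPolynomial.pderiv_X_of_ne hj.symm]
      · simp
    simp only [Derivation.leibniz, smul_eq_mul, mul_add, Finset.sum_add_distrib, prim_X]
    rw [hf, ← h, Finset.mul_sum, Finset.mul_sum]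
    congr 1 <;> exact Finset.sum_congr rfl fun j _ => by ring

theorem prim_zero_of_isHomogeneous {n m : ℕ} {f : Poly p n} (hf : f.IsHomogeneous m) :
    prim p n 0 f = (m : Poly p n) * f := by
  rw [prim_eq_sum, ← nsmul_eq_mul, ← hf.sum_X_mul_pderiv]
  simp

theorem isHomogeneous_prim {n m : ℕ} {f : Poly p n} (hf : f.IsHomogeneous m) (i : ℕ) :
    (prim p n i f).IsHomogeneous (p ^ i + (m - 1)) := by
  rw [prim_eq_sum]
  exact MvPolynomial.IsHomogeneous.sum _ _ _ fun j _ =>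
    (MvPolynomial.isHomogeneous_X_pow j _).mul hf.pderiv

theorem prim_polyAct {n : ℕ} (i : ℕ) (g : Matrix (Fin n) (Fin n) (ZMod p)) (f : Poly p n) :
    prim p n i (polyAct p g f) = polyAct p g (prim p n i f) := by
  induction f using MvPolynomial.induction_on with
  | C a =>
    rw [← MvPolynomial.algebraMap_eq, AlgHom.commutes, Derivation.map_algebraMap, map_zero]
  | add f g hf hg => simp only [map_add, hf, hg]
  | mul_X f j hf =>
    simp only [map_mul, map_add, map_pow, Derivation.leibniz, smul_eq_mul, hf, prim_X, polyAct_X,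
      prim_linForm]

theorem prim_mem {n : ℕ} (i : ℕ) {f : Poly p n} (hf : f ∈ ClassicalDickson p n) :
    prim p n i f ∈ ClassicalDickson p n :=
  (mem_classicalDickson p).2 fun g => by rw [← prim_polyAct, (mem_classicalDickson p).1 hf g]

/-- First-order Taylor expansion of the substitution `yⱼ ↦ yⱼ + yₖ`. -/
theorem X_sq_dvd_polyAct_transvection {n : ℕ} {j k : Fin n} (f : Poly p n) :
    MvPolynomial.X k ^ 2 ∣ polyAct p (Matrix.transvection k j 1) f - f -
      MvPolynomial.X k * MvPolynomial.pderiv j f := by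
  have hX : ∀ l, polyAct p (Matrix.transvection k j 1) (MvPolynomial.X l) =
      MvPolynomial.X l + MvPolynomial.X k * MvPolynomial.pderiv j (MvPolynomial.X l) := by
    intro l
    rw [polyAct_X]
    have : (Matrix.transvection k j (1 : ZMod p)).col l =
        Pi.single l 1 + Pi.single k (if j = l then 1 else 0) := by
      ext i
      simp only [Matrix.col_apply, Matrix.transvection, Matrix.add_apply, Matrix.one_apply,
        Matrix.single_apply, Pi.add_apply, Pi.single_apply]
      by_cases h1 : k = i <;> by_cases h2 : j = l <;> simp [h1, h2, eq_comm]
    rw [this, linForm_add, linForm_single, linForm_single, one_smul, MvPolynomial.pderiv_X,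
      Pi.single_apply]
    by_cases h : j = l
    · simp [h]
    · simp [h, Ne.symm h]
  induction f using MvPolynomial.induction_on with
  | C a =>
    rw [← MvPolynomial.algebraMap_eq, AlgHom.commutes, Derivation.map_algebraMap]
    simp
  | add f g hf hg =>
    have := dvd_add hf hg
    rw [map_add, map_add]
    convert this using 1
    ring
  | mul_X f l hf =>
    obtain ⟨r, hr⟩ := hf
    have hr' : polyAct p (Matrix.transvection k j 1) f =
        f + MvPolynomial.X k * MvPolynomial.pderiv j f + MvPolynomial.X k ^ 2 * r := by
      rw [← hr]; ring
    rw [map_mul, hX, hr', Derivation.leibniz, smul_eq_mul, smul_eq_mul]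
    set d : Poly p n := MvPolynomial.pderiv j (MvPolynomial.X l)
    refine ⟨MvPolynomial.pderiv j f * d + r * (MvPolynomial.X l + MvPolynomial.X k * d), ?_⟩
    ring

/-- Invariance under yⱼ ↦ yⱼ + yₖ leaves only the first-order Taylor term yₖ ∂ⱼf, which must then be
divisible by yₖ². -/
theorem X_dvd_pderiv_of_mem {n : ℕ} {f : Poly p n} (hf : f ∈ ClassicalDickson p n) {j k : Fin n}
    (hjk : k ≠ j) : MvPolynomial.X k ∣ MvPolynomial.pderiv j f := by
  have h := X_sq_dvd_polyAct_transvection (j := j) (k := k) f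
  have hdet : (Matrix.transvection k j (1 : ZMod p)).det ≠ 0 := by
    rw [Matrix.det_transvection_of_ne k j hjk]
    exact one_ne_zero
  have hinv : polyAct p (Matrix.transvection k j 1) f = f :=
    (mem_classicalDickson p).1 hf (Matrix.GeneralLinearGroup.mkOfDetNeZero _ hdet)
  rw [hinv, sub_self, zero_sub, dvd_neg, sq] at h
  exact (mul_dvd_mul_iff_left (MvPolynomial.X_ne_zero k)).1 h

/-- In Σ yⱼ^(p^i) ∂ⱼf the term j = k has the factor yₖ visibly, and the other terms have it by the
transvection argument. -/
theorem eulerClass_dvd_prim {n : ℕ} {f : Poly p n} (hf : f ∈ ClassicalDickson p n) (i : ℕ) :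
    eulerClass p n ∣ prim p n i f := by
  refine eulerClass_dvd (prim_mem i hf) fun k => ?_
  rw [prim_eq_sum]
  refine Finset.dvd_sum fun j _ => ?_
  by_cases hjk : k = j
  · subst hjk
    exact (dvd_pow_self _ (pow_pos (Fact.out : p.Prime).pos i).ne').mul_right _
  · exact (X_dvd_pderiv_of_mem hf hjk).mul_left _

theorem mem_of_mul_mem {n : ℕ} {f g : Poly p n} (hf : f ∈ ClassicalDickson p n) (h0 : f ≠ 0)
    (h : f * g ∈ ClassicalDickson p n) : g ∈ ClassicalDickson p n := by
  refine (mem_classicalDickson p).2 fun a => ?_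
  have := (mem_classicalDickson p).1 h a
  rw [map_mul, (mem_classicalDickson p).1 hf a] at this
  exact mul_left_cancel₀ h0 this

theorem isHomogeneous_of_mul {n a b : ℕ} {f g : Poly p n} (hf : f.IsHomogeneous a) (h0 : f ≠ 0)
    (h : (f * g).IsHomogeneous (a + b)) : g.IsHomogeneous b := by
  have key : f * MvPolynomial.homogeneousComponent b g = f * g := by
    let _ := @MvPolynomial.gradedAlgebra (Fin n) (ZMod p) _
    have hdec : ∀ (φ : Poly p n) (i : ℕ), (DirectSum.decompose
        (MvPolynomial.homogeneousSubmodule (Fin n) (ZMod p)) φ i : Poly p n) =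
        MvPolynomial.homogeneousComponent i φ :=
      MvPolynomial.decomposition.decompose'_apply
    have := DirectSum.coe_decompose_mul_add_of_left_mem
      (MvPolynomial.homogeneousSubmodule (Fin n) (ZMod p)) (j := b) (b := g) hf
    rw [hdec, hdec] at this
    rw [← this]
    exact MvPolynomial.homogeneousComponent_eq_self h
  rw [← mul_left_cancel₀ h0 key]
  exact MvPolynomial.homogeneousComponent_isHomogeneous _ _

/-! ### Power sums of linear forms -/

variable (p) in
/-- The sum of the `(pⁱ - 1)`-st powers of the nonzero linear forms. -/
def powerSum (n i : ℕ) : Poly p n :=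
  ∑ v : {v : Fin n → ZMod p // v ≠ 0}, linForm p v.1 ^ (p ^ i - 1)

/-- Logarithmic derivative of a product, each linear form ℓ satisfying D_i ℓ = ℓ · ℓ^(p^i - 1). -/
theorem prim_eulerClass (n i : ℕ) :
    prim p n i (eulerClass p n) = eulerClass p n * powerSum p n i := by
  classical
  have h : ∀ s : Finset {v : Fin n → ZMod p // v ≠ 0},
      prim p n i (∏ v ∈ s, linForm p v.1) =
        (∏ v ∈ s, linForm p v.1) * ∑ v ∈ s, linForm p v.1 ^ (p ^ i - 1) := by
    intro s
    induction s using Finset.induction_on with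
    | empty => simp
    | insert v s hv ih =>
      rw [Finset.prod_insert hv, Finset.sum_insert hv, Derivation.leibniz, ih, prim_linForm,
        smul_eq_mul, smul_eq_mul]
      have : linForm p v.1 ^ p ^ i = linForm p v.1 * linForm p v.1 ^ (p ^ i - 1) := by
        rw [← pow_succ', Nat.sub_add_cancel (Nat.one_le_pow _ _ (Fact.out : p.Prime).pos)]
      rw [this]
      ring
  exact h Finset.univ

theorem powerSum_mem (n i : ℕ) : powerSum p n i ∈ ClassicalDickson p n := by
  refine (mem_classicalDickson p).2 fun g => ?_
  rw [powerSum, map_sum]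
  simp only [map_pow, polyAct_linForm]
  exact Equiv.sum_comp (nonzeroPerm p g) fun v => linForm p v.1 ^ (p ^ i - 1)

theorem isHomogeneous_powerSum (n i : ℕ) : (powerSum p n i).IsHomogeneous (p ^ i - 1) := by
  refine MvPolynomial.IsHomogeneous.sum _ _ _ fun v _ => ?_
  simpa using (isHomogeneous_linForm p v.1).pow (p ^ i - 1)

/-- Modulo yₖ, forms that differ by a multiple of yₖ coincide, so every summand occurs p times. The
zero form may be included because i ≥ 1 makes the exponent positive. -/
theorem X_dvd_powerSum {n i : ℕ} (hi : 1 ≤ i) (k : Fin n) :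
    MvPolynomial.X k ∣ powerSum p n i := by
  classical
  have hpi : p ^ i - 1 ≠ 0 := by
    have := Nat.one_lt_pow (Nat.one_le_iff_ne_zero.1 hi) (Fact.out : p.Prime).one_lt
    omega
  have h1 : powerSum p n i = ∑ v : Fin n → ZMod p, linForm p v ^ (p ^ i - 1) := by
    rw [← Fintype.sum_subtype_add_sum_subtype (fun v : Fin n → ZMod p => v ≠ 0), powerSum,
      left_eq_add]
    refine Finset.sum_eq_zero fun v _ => ?_
    have : v.1 = 0 := not_not.1 v.2
    rw [this]
    simp [linForm, hpi]
  rw [h1, ← Ideal.mem_span_singleton, ← Ideal.Quotient.eq_zero_iff_mem, map_sum]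
  rw [← Equiv.sum_comp (Equiv.funSplitAt k (ZMod p)).symm, Fintype.sum_prod_type_right]
  refine Finset.sum_eq_zero fun w _ => ?_
  have h2 : ∀ a, (Ideal.Quotient.mk (Ideal.span {(MvPolynomial.X k : Poly p n)}))
      (linForm p ((Equiv.funSplitAt k (ZMod p)).symm (a, w)) ^ (p ^ i - 1)) =
      (Ideal.Quotient.mk (Ideal.span {(MvPolynomial.X k : Poly p n)}))
      (linForm p ((Equiv.funSplitAt k (ZMod p)).symm (0, w)) ^ (p ^ i - 1)) := by
    intro a
    have : (Equiv.funSplitAt k (ZMod p)).symm (a, w) =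
        (Equiv.funSplitAt k (ZMod p)).symm (0, w) + Pi.single k a := by
      ext j
      by_cases hj : j = k
      · subst hj; simp [Equiv.funSplitAt, Equiv.piSplitAt]
      · simp [Equiv.funSplitAt, Equiv.piSplitAt, hj]
    rw [map_pow, map_pow, this, linForm_add, map_add, linForm_single]
    congr 1
    rw [add_eq_left, Ideal.Quotient.eq_zero_iff_mem, Ideal.mem_span_singleton,
      MvPolynomial.smul_eq_C_mul]
    exact dvd_mul_left _ _
  rw [Finset.sum_congr rfl fun a _ => h2 a, Finset.sum_const, Finset.card_univ, ZMod.card,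
    ← map_nsmul, nsmul_eq_mul, CharP.cast_eq_zero, zero_mul, map_zero]

theorem eulerClass_dvd_powerSum {n i : ℕ} (hi : 1 ≤ i) : eulerClass p n ∣ powerSum p n i :=
  eulerClass_dvd (powerSum_mem n i) (X_dvd_powerSum hi)

/-- A multiple of the Euler class whose degree p^i - 1 lies below p^n - 1 must vanish. -/
theorem powerSum_eq_zero {n i : ℕ} (hi : 1 ≤ i) (hin : i < n) : powerSum p n i = 0 := by
  by_contra h0
  obtain ⟨q, hq⟩ := eulerClass_dvd_powerSum (p := p) (n := n) hi
  have hq0 : q ≠ 0 := by rintro rfl; exact h0 (by rw [hq, mul_zero])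
  have h1 := (isHomogeneous_powerSum (p := p) n i).totalDegree h0
  rw [hq, MvPolynomial.totalDegree_mul_of_isDomain (eulerClass_ne_zero p n) hq0,
    (isHomogeneous_eulerClass p n).totalDegree (eulerClass_ne_zero p n)] at h1
  have h2 := Nat.pow_lt_pow_right (Fact.out : p.Prime).one_lt hin
  have h3 := Nat.one_le_pow i p (Fact.out : p.Prime).pos
  omega

/-- At a basis of the field with p^n elements every nonzero linear form takes a nonzero value, whose
(p^n - 1)-st power is 1. The sum becomes p^n - 1 = -1. -/
theorem powerSum_self_ne_zero {n : ℕ} (hn : 1 ≤ n) : powerSum p n n ≠ 0 := by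
  classical
  have : Fintype (GaloisField p n) := Fintype.ofFinite _
  have hfin : Module.finrank (ZMod p) (GaloisField p n) = n :=
    GaloisField.finrank p (Nat.one_le_iff_ne_zero.1 hn)
  let b := Module.finBasisOfFinrankEq (ZMod p) (GaloisField p n) hfin
  intro h
  have h1 := congrArg (MvPolynomial.aeval b) h
  have h2 : ∀ v : {v : Fin n → ZMod p // v ≠ 0},
      MvPolynomial.aeval b (linForm p v.1 ^ (p ^ n - 1)) = 1 := by
    intro v
    have hv : MvPolynomial.aeval b (linForm p v.1) ≠ 0 := by
      intro hv
      simp only [linForm, map_sum, map_smul, MvPolynomial.aeval_X] at hv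
      exact v.2 (funext (Fintype.linearIndependent_iff.1 b.linearIndependent v.1 hv))
    rw [map_pow, ← GaloisField.card p n (Nat.one_le_iff_ne_zero.1 hn), Nat.card_eq_fintype_card]
    exact FiniteField.pow_card_sub_one_eq_one _ hv
  rw [powerSum, map_sum, Finset.sum_congr rfl fun v _ => h2 v, Finset.sum_const, Finset.card_univ,
    card_nonzero, map_zero, nsmul_eq_mul, mul_one,
    Nat.cast_sub (Nat.one_le_pow n p (Fact.out : p.Prime).pos), Nat.cast_pow,
    CharP.cast_eq_zero (GaloisField p n) p, zero_pow (Nat.one_le_iff_ne_zero.1 hn)] at h1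
  simp at h1

theorem exists_powerSum_self_eq {n : ℕ} (hn : 1 ≤ n) :
    ∃ c : ZMod p, c ≠ 0 ∧ powerSum p n n = c • eulerClass p n := by
  have h0 := powerSum_self_ne_zero (p := p) hn
  obtain ⟨q, hq⟩ := eulerClass_dvd_powerSum (p := p) (n := n) hn
  have hq0 : q ≠ 0 := by rintro rfl; exact h0 (by rw [hq, mul_zero])
  have h1 := (isHomogeneous_powerSum (p := p) n n).totalDegree h0
  rw [hq, MvPolynomial.totalDegree_mul_of_isDomain (eulerClass_ne_zero p n) hq0,
    (isHomogeneous_eulerClass p n).totalDegree (eulerClass_ne_zero p n)] at h1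
  have h2 := MvPolynomial.totalDegree_eq_zero_iff_eq_C.1 (by omega : q.totalDegree = 0)
  refine ⟨q.coeff 0, fun h => hq0 (by rw [h2, h, map_zero]), ?_⟩
  rw [hq, h2, MvPolynomial.smul_eq_C_mul, mul_comm]
  simp

theorem prim_eulerClass_eq_zero {n i : ℕ} (hi : 1 ≤ i) (hin : i < n) :
    prim p n i (eulerClass p n) = 0 := by
  rw [prim_eulerClass, powerSum_eq_zero hi hin, mul_zero]

/-! ### Polynomials killed by all primitive derivations -/

variable (p) in
/-- The Moore matrix `(yⱼ^(pⁱ))`. -/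
def moore (n : ℕ) : Matrix (Fin n) (Fin n) (Poly p n) :=
  Matrix.of fun i j => MvPolynomial.X j ^ p ^ (i : ℕ)

/-- A relation between the rows would be a nonzero polynomial of degree below p^n with all p^n
linear forms as roots. -/
theorem moore_det_ne_zero (n : ℕ) : (moore p n).det ≠ 0 := by
  classical
  intro h
  obtain ⟨c, hc, hM⟩ := Matrix.exists_vecMul_eq_zero_iff.2 h
  let q : Polynomial (Poly p n) := ∑ i : Fin n, Polynomial.C (c i) * Polynomial.X ^ p ^ (i : ℕ)
  have hroot : ∀ v : Fin n → ZMod p, q.eval (linForm p v) = 0 := by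
    intro v
    have : q.eval (linForm p v) = ∑ j, v j • (Matrix.vecMul c (moore p n)) j := by
      simp only [q, Polynomial.eval_finsetSum, Polynomial.eval_mul, Polynomial.eval_C,
        Polynomial.eval_pow, Polynomial.eval_X, linForm_pow, Matrix.vecMul, dotProduct, moore,
        Matrix.of_apply, Finset.mul_sum, Finset.smul_sum, mul_smul_comm]
      rw [Finset.sum_comm]
    rw [this, hM]
    simp
  have hq : q = 0 := by
    refine Polynomial.eq_zero_of_natDegree_lt_card_of_eval_eq_zero q (linForm_injective p)
      hroot ?_
    rw [Fintype.card_fun, ZMod.card, Fintype.card_fin]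
    refine lt_of_le_of_lt (Polynomial.natDegree_sum_le_of_forall_le (n := p ^ n - 1) _ _
      fun i _ => ?_) (Nat.sub_lt (pow_pos (Fact.out : p.Prime).pos n) one_pos)
    refine (Polynomial.natDegree_C_mul_X_pow_le _ _).trans ?_
    exact Nat.le_sub_one_of_lt (Nat.pow_lt_pow_right (Fact.out : p.Prime).one_lt i.2)
  refine hc (funext fun i => ?_)
  have h1 := congrArg (fun r => Polynomial.coeff r (p ^ (i : ℕ))) hq
  simp only [q, Polynomial.finsetSum_coeff, Polynomial.coeff_C_mul_X_pow, Polynomial.coeff_zero]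
    at h1
  rw [Finset.sum_eq_single i] at h1
  · simpa using h1
  · intro j _ hj
    rw [if_neg]
    intro h2
    exact hj (Fin.ext (Nat.pow_right_injective (Fact.out : p.Prime).two_le h2).symm)
  · simp

theorem pderiv_eq_zero_of_prim_eq_zero {n : ℕ} {f : Poly p n} (h : ∀ i < n, prim p n i f = 0)
    (j : Fin n) : MvPolynomial.pderiv j f = 0 := by
  have h1 : (moore p n).mulVec (fun j => MvPolynomial.pderiv j f) = 0 := by
    ext1 i
    have := h i i.2
    rw [prim_eq_sum] at this
    simpa [Matrix.mulVec, dotProduct, moore] using this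
  exact congrFun (Matrix.eq_zero_of_mulVec_eq_zero (moore_det_ne_zero n) h1) j

/-- All exponents are divisible by p, and the coefficients, lying in ℤ/p, are their own p-th powers.
-/
theorem exists_pow_eq_of_pderiv_eq_zero {n m : ℕ} {f : Poly p n} (hm : f.IsHomogeneous m)
    (hf0 : f ≠ 0) (h : ∀ j, MvPolynomial.pderiv j f = 0) :
    ∃ (g : Poly p n) (d : ℕ), f = g ^ p ∧ g.IsHomogeneous d ∧ m = p * d := by
  have hp := (Fact.out : p.Prime).ne_zero
  have hs : ∀ s ∈ f.support, ∃ t : Fin n →₀ ℕ, s = p • t := by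
    intro s hs
    have hdvd : ∀ j, p ∣ s j := by
      intro j
      by_cases hj : s j = 0
      · rw [hj]; exact dvd_zero _
      have h1 := congrArg (MvPolynomial.coeff (s - Finsupp.single j 1)) (h j)
      rw [MvPolynomial.coeff_pderiv, MvPolynomial.coeff_zero] at h1
      have h2 : s - Finsupp.single j 1 + Finsupp.single j 1 = s :=
        tsub_add_cancel_of_le (by rw [Finsupp.single_le_iff]; omega)
      have h3 : (s - Finsupp.single j 1 : Fin n →₀ ℕ) j + 1 = s j := by
        simp; omega
      rw [h2] at h1
      have h4 : ((s j : ℕ) : ZMod p) = 0 := by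
        rw [← h3]
        have := h1
        push_cast
        rcases mul_eq_zero.1 this with h5 | h5
        · exact absurd h5 (MvPolynomial.mem_support_iff.1 hs)
        · exact h5
      exact (ZMod.natCast_eq_zero_iff _ _).1 h4
    refine ⟨s.mapRange (· / p) (Nat.zero_div p), ?_⟩
    ext j
    simp [Nat.mul_div_cancel' (hdvd j)]
  choose! r hr using hs
  let g : Poly p n := ∑ s ∈ f.support, MvPolynomial.monomial (r s) (f.coeff s)
  have hg : f = g ^ p := by
    rw [sum_pow_char]
    conv_lhs => rw [f.as_sum]
    refine Finset.sum_congr rfl fun s hs => ?_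
    rw [MvPolynomial.monomial_pow, ZMod.pow_card, ← hr s hs]
  have hdeg : ∀ s ∈ f.support, p * (r s).degree = m := by
    intro s hs
    have h1 : s.degree = m := by
      by_contra h1
      exact MvPolynomial.mem_support_iff.1 hs (hm.coeff_eq_zero h1)
    rw [← h1, hr s hs, map_nsmul, smul_eq_mul, ← hr s hs]
  obtain ⟨s₀, hs₀⟩ := MvPolynomial.support_nonempty.2 hf0
  refine ⟨g, (r s₀).degree, hg, ?_, (hdeg s₀ hs₀).symm⟩
  refine MvPolynomial.IsHomogeneous.sum _ _ _ fun s hs => ?_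
  refine MvPolynomial.isHomogeneous_monomial _ ?_
  exact Nat.eq_of_mul_eq_mul_left (Nat.pos_of_ne_zero hp) ((hdeg s hs).trans (hdeg s₀ hs₀).symm)

theorem mem_of_pow_mem {n : ℕ} {g : Poly p n} (h : g ^ p ∈ ClassicalDickson p n) :
    g ∈ ClassicalDickson p n := by
  refine (mem_classicalDickson p).2 fun a => ?_
  have := (mem_classicalDickson p).1 h a
  rw [map_pow] at this
  exact frobenius_inj (Poly p n) p this

/-! ### Powers of the Euler class in stable subspaces -/

theorem prim_self_eulerClass_pow_mul {n : ℕ} {c : ZMod p}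
    (hc : powerSum p n n = c • eulerClass p n) {b : ℕ} (hb : b ≠ 0) (h : Poly p n) :
    prim p n n (eulerClass p n ^ b * h ^ p) =
      ((b : ZMod p) * c) • (eulerClass p n ^ (b + 1) * h ^ p) := by
  obtain ⟨b, rfl⟩ := Nat.exists_eq_succ_of_ne_zero hb
  rw [Derivation.leibniz, prim_pow_char, smul_zero, zero_add, Derivation.leibniz_pow,
    prim_eulerClass, hc, Nat.succ_eq_add_one, Nat.add_sub_cancel]
  simp only [smul_eq_mul, MvPolynomial.smul_eq_C_mul, nsmul_eq_mul, map_mul, map_natCast]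
  ring

/-- `prim n` raises the exponent b of the Euler class by one, up to a factor that vanishes only if p
divides b. The bounds make p a' the first multiple of p from a on, so the climb is never blocked
before it; there a p-th root can be taken. -/
theorem PowerStable.eulerClass_pow_mul_mem {n : ℕ} (hn : 1 ≤ n)
    {W : Submodule (ZMod p) (Poly p n)} (hW : PowerStable p W) {a a' k : ℕ} {h : Poly p n}
    (ha : a ≤ p * a') (ha' : p * a' < a + p) (hh : (eulerClass p n ^ a * h ^ p) ^ p ^ k ∈ W) :
    (eulerClass p n ^ a' * h) ^ p ^ (k + 1) ∈ W := by
  obtain ⟨c, hc0, hc⟩ := exists_powerSum_self_eq (p := p) hn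
  have key : ∀ b, a ≤ b → b ≤ p * a' → (eulerClass p n ^ b * h ^ p) ^ p ^ k ∈ W := by
    intro b hab
    induction b, hab using Nat.le_induction with
    | base => exact fun _ => hh
    | succ b hab ih =>
      intro hb
      have hpb : ¬ p ∣ b := by
        rintro ⟨q, rfl⟩
        have h1 : q < a' := Nat.lt_of_mul_lt_mul_left (Nat.lt_of_succ_le hb)
        have h2 : p * (q + 1) ≤ p * a' := Nat.mul_le_mul_left _ h1
        rw [mul_add, mul_one] at h2
        omega
      have hb0 : b ≠ 0 := by rintro rfl; exact hpb (dvd_zero _)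
      have h1 := hW.prim_pow_mem (ih (by omega)) hn
      have hu : (b : ZMod p) * c ≠ 0 :=
        mul_ne_zero (fun h0 => hpb ((ZMod.natCast_eq_zero_iff _ _).1 h0)) hc0
      rw [prim_self_eulerClass_pow_mul hc hb0, smul_pow, ZMod.pow_card_pow] at h1
      exact (W.smul_mem_iff hu).1 h1
  have := key (p * a') ha le_rfl
  rwa [mul_comm p, pow_mul, ← mul_pow, ← pow_mul, ← pow_succ'] at this

/-- The witness is ⌈a/p⌉. Its only positive fixed point is 1, where the descent on exponents stops.
-/
theorem exists_ceil_div (p : ℕ) (hp : 2 ≤ p) (a : ℕ) :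
    ∃ a', a ≤ p * a' ∧ p * a' < a + p ∧ (1 < a → a' < a) ∧ (0 < a → 0 < a') := by
  have h1 := Nat.div_add_mod (a + (p - 1)) p
  have h2 := Nat.mod_lt (a + (p - 1)) (by omega : p > 0)
  refine ⟨(a + (p - 1)) / p, by omega, by omega, fun ha => ?_, fun ha => ?_⟩
  · rw [Nat.div_lt_iff_lt_mul (by omega)]
    nlinarith [Nat.sub_add_cancel (by omega : 1 ≤ p)]
  · exact Nat.div_pos (by omega) (by omega)

theorem PowerStable.exists_eulerClass_pow_mem {n : ℕ} (hn : 1 ≤ n)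
    {W : Submodule (ZMod p) (Poly p n)} (hW : PowerStable p W) {a k : ℕ} (ha : 0 < a)
    (h : (eulerClass p n ^ a) ^ p ^ k ∈ W) : ∃ K, eulerClass p n ^ p ^ K ∈ W := by
  induction a using Nat.strong_induction_on generalizing k with
  | _ a ih =>
    rcases Nat.lt_or_ge 1 a with h1 | h1
    · obtain ⟨a', h2, h3, h4, h5⟩ := exists_ceil_div p (Fact.out : p.Prime).two_le a
      have := hW.eulerClass_pow_mul_mem hn (h := 1) (k := k) h2 h3 (by simpa using h)
      rw [mul_one] at this
      exact ih a' (h4 h1) (h5 ha) this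
    · obtain rfl : a = 1 := by omega
      exact ⟨k, by simpa using h⟩

theorem PowerStable.eulerClass_pow_mem_of_le {n : ℕ} (hn : 1 ≤ n)
    {W : Submodule (ZMod p) (Poly p n)} (hW : PowerStable p W) {K k : ℕ} (hk : K ≤ k)
    (h : eulerClass p n ^ p ^ K ∈ W) : eulerClass p n ^ p ^ k ∈ W := by
  induction k, hk using Nat.le_induction with
  | base => exact h
  | succ k _ ih =>
    have hp := (Fact.out : p.Prime).two_le
    simpa using hW.eulerClass_pow_mul_mem hn (a := 1) (a' := 1) (h := 1) (k := k) (by omega)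
      (by omega) (by simpa using ih)

/-- A homogeneous invariant killed by the primitives `prim 1, …, prim (n - 1)` is the product of a
power of the Euler class and a `p`-th power. -/
theorem exists_eq_eulerClass_pow_mul_pow {n m : ℕ} (hn : 1 ≤ n) {g : Poly p n}
    (hg : g ∈ ClassicalDickson p n) (hg0 : g ≠ 0) (hm : g.IsHomogeneous m) (hm0 : 0 < m)
    (hD : ∀ i, 1 ≤ i → i < n → prim p n i g = 0) :
    ∃ (b d : ℕ) (h : Poly p n), g = eulerClass p n ^ b * h ^ p ∧ h ∈ ClassicalDickson p n ∧
      h.IsHomogeneous d ∧ d < m ∧ (0 < b ∨ 0 < d) := by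
  have hp := (Fact.out : p.Prime)
  have hE := eulerClass_ne_zero p n
  have hlast : ∀ (b d : ℕ) (h : Poly p n), g = eulerClass p n ^ b * h ^ p →
      h.IsHomogeneous d → h ≠ 0 → d < m ∧ (0 < b ∨ 0 < d) := by
    intro b d h h1 h2 h3
    have h4 := hm.inj_right (h1 ▸ ((isHomogeneous_eulerClass p n).pow b).mul (h2.pow p)) hg0
    have h5 : 1 ≤ p ^ n - 1 := by
      have := Nat.one_lt_pow (Nat.one_le_iff_ne_zero.1 hn) hp.one_lt
      omega
    have h6 := hp.two_le
    rcases Nat.eq_zero_or_pos b with rfl | hb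
    · rw [mul_zero, zero_add] at h4
      have hd : 0 < d := by
        rcases Nat.eq_zero_or_pos d with rfl | hd
        · omega
        · exact hd
      exact ⟨by nlinarith, Or.inr hd⟩
    · exact ⟨by nlinarith, Or.inl hb⟩
  -- Since deg E = p^n - 1 is -1 modulo p, multiplying g by this power of E makes the degree
  -- divisible by p, so that `prim 0` vanishes as well.
  set e := m % p with he
  have hep : e < p := Nat.mod_lt _ hp.pos
  set f := eulerClass p n ^ e * g with hf
  have hf0 : f ≠ 0 := mul_ne_zero (pow_ne_zero _ hE) hg0
  have hfm : f.IsHomogeneous ((p ^ n - 1) * e + m) :=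
    ((isHomogeneous_eulerClass p n).pow e).mul hm
  have hfmem : f ∈ ClassicalDickson p n := mul_mem (pow_mem (eulerClass_mem p n) _) hg
  have hfD : ∀ i < n, prim p n i f = 0 := by
    intro i hi
    rcases Nat.eq_zero_or_pos i with rfl | hi0
    · rw [prim_zero_of_isHomogeneous hfm]
      have : p ∣ (p ^ n - 1) * e + m := by
        have h1 : m = p * (m / p) + e := (Nat.div_add_mod m p).symm
        have h2 : (p ^ n - 1) * e + e = p ^ n * e := by
          rw [← Nat.succ_mul, Nat.succ_eq_add_one,
            Nat.sub_add_cancel (Nat.one_le_pow n p hp.pos)]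
        rw [h1, add_comm (p * _), ← add_assoc, h2]
        exact dvd_add ((dvd_pow_self p (by omega)).mul_right _) (dvd_mul_right _ _)
      rw [(CharP.cast_eq_zero_iff (Poly p n) p _).2 this, zero_mul]
    · rw [hf, Derivation.leibniz, hD i hi0 hi, Derivation.leibniz_pow,
        prim_eulerClass_eq_zero hi0 hi]
      simp
  obtain ⟨r, d, hr, hrd, hmd⟩ := exists_pow_eq_of_pderiv_eq_zero hfm hf0
    (pderiv_eq_zero_of_prim_eq_zero hfD)
  have hr0 : r ≠ 0 := by
    rintro rfl
    exact hf0 (by rw [hr, zero_pow hp.ne_zero])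
  have hrmem : r ∈ ClassicalDickson p n := mem_of_pow_mem (hr ▸ hfmem)
  rcases Nat.eq_zero_or_pos e with he0 | he0
  · have hg' : g = eulerClass p n ^ 0 * r ^ p := by rw [← hr, hf, he0]; ring
    exact ⟨0, d, r, hg', hrmem, hrd, hlast 0 d r hg' hrd hr0⟩
  -- Each yₖ divides E^e g = r^p, hence r, and r is invariant. Cancelling E^e from E^p q^p leaves
  -- the exponent p - e.
  · have hdvd : eulerClass p n ∣ r := by
      refine eulerClass_dvd hrmem fun k => ?_
      refine (MvPolynomial.X_prime (i := k)).dvd_of_dvd_pow (n := p) ?_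
      rw [← hr]
      exact ((X_dvd_eulerClass p k).trans (dvd_pow_self _ he0.ne')).mul_right _
    obtain ⟨q, rfl⟩ := hdvd
    have hq0 : q ≠ 0 := right_ne_zero_of_mul hr0
    have hle : p ^ n - 1 ≤ d := by
      have h1 := hrd.totalDegree hr0
      rw [MvPolynomial.totalDegree_mul_of_isDomain hE hq0,
        (isHomogeneous_eulerClass p n).totalDegree hE] at h1
      omega
    have hq : q.IsHomogeneous (d - (p ^ n - 1)) :=
      isHomogeneous_of_mul (isHomogeneous_eulerClass p n) hE
        (by rwa [Nat.add_sub_cancel' hle])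
    have hg' : g = eulerClass p n ^ (p - e) * q ^ p := by
      refine mul_left_cancel₀ (pow_ne_zero e hE) ?_
      rw [← hf, hr, ← mul_assoc, ← pow_add, Nat.add_sub_cancel' hep.le, mul_pow]
    exact ⟨p - e, _, q, hg', mem_of_mul_mem (eulerClass_mem p n) hE hrmem, hq,
      hlast _ _ q hg' hq hq0⟩

/-- Strong induction on the degree of g; the exponents a and k are free to grow. The condition that
a or m be positive excludes constants, which carry no information. -/
theorem PowerStable.exists_eulerClass_pow_mem_of_isHomogeneous {n : ℕ} (hn : 1 ≤ n)
    {W : Submodule (ZMod p) (Poly p n)} (hW : PowerStable p W) {m a k : ℕ} {g : Poly p n}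
    (hg : g ∈ ClassicalDickson p n) (hg0 : g ≠ 0) (hm : g.IsHomogeneous m) (ham : 0 < a ∨ 0 < m)
    (h : (eulerClass p n ^ a * g) ^ p ^ k ∈ W) : ∃ K, eulerClass p n ^ p ^ K ∈ W := by
  have hp := (Fact.out : p.Prime)
  have hE := eulerClass_ne_zero p n
  induction m using Nat.strong_induction_on generalizing a k g with
  | _ m ih =>
    rcases Nat.eq_zero_or_pos m with rfl | hm0
    · have ha : 0 < a := by simpa using ham
      have hC : g = MvPolynomial.C (g.coeff 0) :=
        MvPolynomial.totalDegree_eq_zero_iff_eq_C.1 (hm.totalDegree hg0)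
      have hc : g.coeff 0 ≠ 0 := fun h0 => hg0 (by rw [hC, h0, map_zero])
      rw [hC, mul_comm, ← MvPolynomial.smul_eq_C_mul, smul_pow, ZMod.pow_card_pow,
        W.smul_mem_iff hc] at h
      exact hW.exists_eulerClass_pow_mem hn ha h
    · by_cases hD : ∀ i, 1 ≤ i → i < n → prim p n i g = 0
      · obtain ⟨b, d, q, rfl, hq, hqd, hdm, hbd⟩ :=
          exists_eq_eulerClass_pow_mul_pow hn hg hg0 hm hm0 hD
        have hq0 : q ≠ 0 := by
          rintro rfl
          exact hg0 (by rw [zero_pow hp.ne_zero, mul_zero])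
        obtain ⟨a', h2, h3, -, h5⟩ := exists_ceil_div p hp.two_le (a + b)
        rw [← mul_assoc, ← pow_add] at h
        refine ih d hdm hq hq0 hqd ?_ (hW.eulerClass_pow_mul_mem hn h2 h3 h)
        exact hbd.imp (fun hb => h5 (by omega)) id
      · push Not at hD
        obtain ⟨i, hi, hin, hne⟩ := hD
        obtain ⟨q, hq⟩ := eulerClass_dvd_prim hg i
        have hq0 : q ≠ 0 := by
          rintro rfl
          exact hne (by rw [hq, mul_zero])
        have hlt := Nat.pow_lt_pow_right hp.one_lt hin
        have hhom := isHomogeneous_prim hm i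
        have hle : p ^ n - 1 ≤ p ^ i + (m - 1) := by
          have h1 := hhom.totalDegree hne
          rw [hq, MvPolynomial.totalDegree_mul_of_isDomain hE hq0,
            (isHomogeneous_eulerClass p n).totalDegree hE] at h1
          omega
        have hqhom : q.IsHomogeneous (p ^ i + (m - 1) - (p ^ n - 1)) :=
          isHomogeneous_of_mul (isHomogeneous_eulerClass p n) hE
            (by rwa [Nat.add_sub_cancel' hle, ← hq])
        have hqmem := mem_of_mul_mem (eulerClass_mem p n) hE (hq ▸ prim_mem i hg)
        -- The new degree is m - (p^n - p^i), smaller than m because i < n.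
        refine ih _ (by omega) (a := a + 1) (k := k) hqmem hq0 hqhom (Or.inl a.succ_pos) ?_
        have h1 := hW.prim_pow_mem h hi
        rw [Derivation.leibniz, Derivation.leibniz_pow, prim_eulerClass_eq_zero hi hin, hq,
          smul_zero, smul_zero, smul_zero, add_zero, smul_eq_mul, ← mul_assoc, ← pow_succ] at h1
        exact h1

theorem homogeneousComponent_mem_of_mem {n : ℕ} {f : Poly p n} (hf : f ∈ ClassicalDickson p n)
    (d : ℕ) : MvPolynomial.homogeneousComponent d f ∈ ClassicalDickson p n := by
  refine (mem_classicalDickson p).2 fun g => ?_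
  have key : ∀ f : Poly p n, polyAct p g.1 (MvPolynomial.homogeneousComponent d f) =
      MvPolynomial.homogeneousComponent d (polyAct p g.1 f) := by
    intro f
    have hact : ∀ {e : ℕ} {q : Poly p n}, q.IsHomogeneous e →
        (polyAct p g.1 q).IsHomogeneous e := by
      intro e q hq
      have := hq.aeval (fun j => polyAct p g.1 (MvPolynomial.X j)) (n := 1)
        (fun j => by rw [polyAct_X]; exact isHomogeneous_linForm p _)
      rw [one_mul] at this
      convert this using 1
      simp [polyAct]
    conv_rhs => rw [← MvPolynomial.sum_homogeneousComponent f]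
    rw [map_sum, map_sum]
    simp_rw [MvPolynomial.homogeneousComponent_of_mem
      (hact (MvPolynomial.homogeneousComponent_isHomogeneous _ f))]
    rw [Finset.sum_ite_eq]
    split_ifs with h
    · rfl
    · rw [MvPolynomial.homogeneousComponent_eq_zero, map_zero]
      simpa using h
  rw [key, (mem_classicalDickson p).1 hf g]

/-- A stable subspace that contains a nonzero invariant without constant term contains almost all
`pᵏ`-th powers of the Euler class. -/
theorem PowerStable.exists_forall_eulerClass_pow_mem {n : ℕ} (hn : 1 ≤ n)
    {W : Submodule (ZMod p) (Poly p n)} (hW : PowerStable p W) {f : Poly p n} (hfW : f ∈ W)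
    (hf0 : f ≠ 0) (hf : f ∈ ClassicalDickson p n) (haug : polyAug p n f = 0) :
    ∃ K, ∀ k, K ≤ k → eulerClass p n ^ p ^ k ∈ W := by
  have hd : 0 < f.totalDegree := by
    refine Nat.pos_of_ne_zero fun h => hf0 ?_
    rw [MvPolynomial.totalDegree_eq_zero_iff_eq_C.1 h] at haug ⊢
    rw [polyAug, ← MvPolynomial.algebraMap_eq, AlgHom.commutes] at haug
    rw [show f.coeff 0 = 0 from haug, map_zero]
  have htop : MvPolynomial.homogeneousComponent f.totalDegree f ≠ 0 := by
    obtain ⟨s, hs, hsd⟩ := Finset.exists_mem_eq_sup f.support (MvPolynomial.support_nonempty.2 hf0)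
      (fun s => s.sum fun _ e => e)
    intro h0
    have := congrArg (MvPolynomial.coeff s) h0
    rw [MvPolynomial.coeff_homogeneousComponent, 
      if_pos (show s.degree = f.totalDegree from hsd.symm)] at this
    exact MvPolynomial.mem_support_iff.1 hs this
  -- The top operation isolates the leading form, already as a p-th power, whence k = 1 below.
  have h1 := hW f.totalDegree f hfW
  rw [polyPower_totalDegree] at h1
  obtain ⟨K, hK⟩ := hW.exists_eulerClass_pow_mem_of_isHomogeneous hn (a := 0) (k := 1)
    (homogeneousComponent_mem_of_mem hf _) htop
    (MvPolynomial.homogeneousComponent_isHomogeneous _ f) (Or.inr hd) (by simpa using h1)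
  exact ⟨K, fun k hk => hW.eulerClass_pow_mem_of_le hn hk hK⟩

/-! ### Milnor operations on `E ⊗ P` -/

variable (p) in
/-- The signed derivation of the exterior algebra with `xₗ ↦ δⱼₗ`. -/
def contract {n : ℕ} (j : Fin n) : Ext p n →ₗ[ZMod p] Ext p n :=
  CliffordAlgebra.contractLeft (Q := (0 : QuadraticForm (ZMod p) (Fin n → ZMod p)))
    (LinearMap.proj j)

theorem contract_contract {n : ℕ} (j l : Fin n) (e : Ext p n) :
    contract p j (contract p l e) = -contract p l (contract p j e) :=
  CliffordAlgebra.contractLeft_comm (Q := (0 : QuadraticForm (ZMod p) (Fin n → ZMod p)))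
    (LinearMap.proj j) (LinearMap.proj l) e

variable (p) in
/-- The signed derivation with `xⱼ ↦ yⱼ^(pⁱ)` and `yⱼ ↦ 0`. -/
def milnor (n i : ℕ) : Module.End (ZMod p) (Coh p n) :=
  ∑ j, TensorProduct.map (contract p j)
    (LinearMap.mulLeft (ZMod p) (MvPolynomial.X j ^ p ^ i : Poly p n))

theorem milnor_tmul {n : ℕ} (i : ℕ) (e : Ext p n) (f : Poly p n) :
    milnor p n i (e ⊗ₜ f) = ∑ j, contract p j e ⊗ₜ[ZMod p] (MvPolynomial.X j ^ p ^ i * f) := by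
  simp [milnor, LinearMap.sum_apply]

theorem milnor_zero (n : ℕ) : milnor p n 0 = bockstein p n := by
  simp [milnor, bockstein, contract]

/-- The terms in which the reduced power misses yⱼ^(p^i) cancel in the commutator; the one remaining
raises it to yⱼ^(p^(i+1)). -/
theorem milnor_succ {n : ℕ} (i : ℕ) (z : Coh p n) :
    milnor p n (i + 1) z =
      power p (p ^ i) n (milnor p n i z) - milnor p n i (power p (p ^ i) n z) := by
  induction z using TensorProduct.induction_on with
  | zero => simp
  | add x y hx hy => simp only [map_add, hx, hy]; abel
  | tmul e f =>
    simp only [milnor_tmul, power, LinearMap.lTensor_tmul, map_sum]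
    rw [← Finset.sum_sub_distrib]
    refine Finset.sum_congr rfl fun j _ => ?_
    rw [polyPower_X_pow_mul, polyPower_zero, TensorProduct.tmul_add, add_sub_cancel_left]

theorem milnor_milnor {n : ℕ} (a b : ℕ) (z : Coh p n) :
    milnor p n a (milnor p n b z) = -milnor p n b (milnor p n a z) := by
  induction z using TensorProduct.induction_on with
  | zero => simp
  | add x y hx hy => simp only [map_add, hx, hy]; abel
  | tmul e f =>
    simp only [milnor_tmul, map_sum]
    rw [Finset.sum_comm, ← Finset.sum_neg_distrib]
    refine Finset.sum_congr rfl fun j _ => ?_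
    rw [← Finset.sum_neg_distrib]
    refine Finset.sum_congr rfl fun l _ => ?_
    rw [contract_contract, TensorProduct.neg_tmul, mul_left_comm]

/-- Anticommutation gives only 2 Q² = 0, so p must be odd. -/
theorem milnor_milnor_self (hp : p ≠ 2) {n : ℕ} (a : ℕ) (z : Coh p n) :
    milnor p n a (milnor p n a z) = 0 := by
  have h := milnor_milnor a a z
  rw [eq_neg_iff_add_eq_zero, ← two_smul (ZMod p)] at h
  refine (smul_eq_zero.1 h).resolve_left fun h2 => hp ?_
  have h3 : ((2 : ℕ) : ZMod p) = 0 := by exact_mod_cast h2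
  exact (Nat.prime_dvd_prime_iff_eq (Fact.out : p.Prime) Nat.prime_two).1
    ((ZMod.natCast_eq_zero_iff _ _).1 h3)

theorem lTensor_mulLeft_apply {n : ℕ} (a : Poly p n) (z : Coh p n) :
    LinearMap.lTensor (Ext p n) (LinearMap.mulLeft (ZMod p) a) z = ((1 : Ext p n) ⊗ₜ a) * z := by
  induction z using TensorProduct.induction_on with
  | zero => simp
  | add x y hx hy => rw [map_add, hx, hy, mul_add]
  | tmul e f => simp

theorem eq_zero_of_one_tmul_mul_eq_zero {n : ℕ} {a : Poly p n} (ha : a ≠ 0) {z : Coh p n}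
    (h : ((1 : Ext p n) ⊗ₜ a) * z = 0) : z = 0 := by
  rw [← lTensor_mulLeft_apply] at h
  have hinj : Function.Injective (LinearMap.mulLeft (ZMod p) a) := mul_right_injective₀ ha
  exact (Module.Flat.lTensor_preserves_injective_linearMap (M := Ext p n) _ hinj)
    (h.trans (map_zero _).symm)

theorem milnor_eq_sum {n : ℕ} (i : ℕ) (z : Coh p n) :
    milnor p n i z = ∑ j, ((1 : Ext p n) ⊗ₜ[ZMod p] (MvPolynomial.X j ^ p ^ i : Poly p n)) *
      LinearMap.rTensor (Poly p n) (contract p j) z := by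
  induction z using TensorProduct.induction_on with
  | zero => simp
  | add x y hx hy => simp only [map_add, hx, hy, mul_add, Finset.sum_add_distrib]
  | tmul e f => simp [milnor_tmul]

/-- Cramer's rule: the equations Q_i z = 0 form a linear system with the Moore matrix, and
multiplication by its determinant is injective on E ⊗ P. -/
theorem rTensor_contract_eq_zero {n : ℕ} {z : Coh p n} (h : ∀ i < n, milnor p n i z = 0)
    (k : Fin n) : LinearMap.rTensor (Poly p n) (contract p k) z = 0 := by
  refine eq_zero_of_one_tmul_mul_eq_zero (moore_det_ne_zero (p := p) n) ?_
  let u : Poly p n →ₐ[ZMod p] Coh p n := Algebra.TensorProduct.includeRight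
  have hu : ∀ a, (1 : Ext p n) ⊗ₜ[ZMod p] a = u a := fun _ => rfl
  let w : Fin n → Coh p n := fun j => LinearMap.rTensor (Poly p n) (contract p j) z
  have h1 : ∀ i : Fin n, ∑ j, u (moore p n i j) * w j = 0 := by
    intro i
    rw [← h i i.2, milnor_eq_sum]
    rfl
  have h2 : ∑ i, u ((moore p n).adjugate k i) * ∑ j, u (moore p n i j) * w j =
      ∑ j, u (((moore p n).adjugate * moore p n) k j) * w j := by
    simp only [Matrix.mul_apply, map_sum, map_mul, Finset.sum_mul, Finset.mul_sum]
    rw [Finset.sum_comm]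
    simp only [mul_assoc]
  rw [Matrix.adjugate_mul] at h2
  simp only [h1, mul_zero, Finset.sum_const_zero, Matrix.smul_apply, Matrix.one_apply,
    smul_eq_mul, mul_ite, mul_one] at h2
  rw [Finset.sum_eq_single k] at h2
  · rw [hu]
    simpa using h2.symm
  · intro j _ hj
    simp [hj.symm]
  · simp

/-! ### Elements killed by all contractions -/

variable (p) in
/-- The coordinate projection of `(ℤ/p)ⁿ` that kills the coordinates in `s`. -/
def coordKill {n : ℕ} (s : Finset (Fin n)) : (Fin n → ZMod p) →ₗ[ZMod p] (Fin n → ZMod p) :=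
  LinearMap.pi fun i => if i ∈ s then 0 else LinearMap.proj i

theorem coordKill_apply {n : ℕ} (s : Finset (Fin n)) (v : Fin n → ZMod p) (i : Fin n) :
    coordKill p s v i = if i ∈ s then 0 else v i := by
  rw [coordKill, LinearMap.pi_apply]
  split_ifs <;> rfl

/-- Splits e by the occurrence of xⱼ, with the contraction supplying the cofactor. An element killed
by the contraction is therefore fixed by xⱼ ↦ 0. -/
theorem ext_eq_map_coordKill_add {n : ℕ} (j : Fin n) (e : Ext p n) :
    e = ExteriorAlgebra.map (coordKill p {j}) e +
      ExteriorAlgebra.ι (ZMod p) (Pi.single j 1) *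
        ExteriorAlgebra.map (coordKill p {j}) (contract p j e) := by
  induction e using CliffordAlgebra.left_induction with
  | algebraMap r =>
    have h1 : contract p j (algebraMap (ZMod p) (Ext p n) r) = 0 :=
      CliffordAlgebra.contractLeft_algebraMap
        (0 : QuadraticForm (ZMod p) (Fin n → ZMod p)) (LinearMap.proj j) r
    change algebraMap (ZMod p) (Ext p n) r = _ + _ * ExteriorAlgebra.map _
      (contract p j (algebraMap (ZMod p) (Ext p n) r))
    rw [h1, map_zero, mul_zero, add_zero]
    exact (AlgHom.commutes _ _).symm
  | add x y hx hy =>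
    rw [map_add, map_add, map_add, mul_add]
    nth_rewrite 1 [hx, hy]
    abel
  | ι_mul x m hx =>
    change ExteriorAlgebra.ι (ZMod p) m * x = ExteriorAlgebra.map (coordKill p {j})
      (ExteriorAlgebra.ι (ZMod p) m * x) + ExteriorAlgebra.ι (ZMod p) (Pi.single j 1) *
        ExteriorAlgebra.map (coordKill p {j}) (contract p j (ExteriorAlgebra.ι (ZMod p) m * x))
    have h1 : contract p j (ExteriorAlgebra.ι (ZMod p) m * x) =
        m j • x - ExteriorAlgebra.ι (ZMod p) m * contract p j x :=
      CliffordAlgebra.contractLeft_ι_mul _ _ _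
    have hm : m = coordKill p {j} m + m j • Pi.single j 1 := by
      ext i
      by_cases hi : i = j
      · subst hi; simp [coordKill_apply]
      · simp [coordKill_apply, hi]
    set A := ExteriorAlgebra.ι (ZMod p) (coordKill p {j} m) with hA
    set B := ExteriorAlgebra.ι (ZMod p) (Pi.single j 1 : Fin n → ZMod p) with hB
    have hBB : B * B = 0 := ExteriorAlgebra.ι_sq_zero _
    have hAB : B * A = -(A * B) := by
      rw [eq_neg_iff_add_eq_zero, add_comm]
      exact ExteriorAlgebra.ι_add_mul_swap _ _
    have hιm : ExteriorAlgebra.ι (ZMod p) m = A + m j • B := by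
      conv_lhs => rw [hm]
      rw [map_add, map_smul]
    rw [h1, map_mul, map_sub, map_smul, map_mul, ExteriorAlgebra.map_apply_ι, ← hA, hιm]
    set y := ExteriorAlgebra.map (coordKill p {j}) x
    set y' := ExteriorAlgebra.map (coordKill p {j}) (contract p j x)
    have e1 : B * (A * y') = -(A * (B * y')) := by
      rw [← mul_assoc, hAB, neg_mul, mul_assoc]
    have e2 : B * (B * y') = 0 := by rw [← mul_assoc, hBB, zero_mul]
    conv_lhs => rw [hx]
    rw [mul_sub, e1, add_mul, mul_add, smul_mul_assoc, mul_add, e2, add_zero, mul_smul_comm]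
    abel

theorem rTensor_map_coordKill {n : ℕ} {z : Coh p n}
    (h : ∀ j, LinearMap.rTensor (Poly p n) (contract p j) z = 0) (s : Finset (Fin n)) :
    LinearMap.rTensor (Poly p n) (ExteriorAlgebra.map (coordKill p s)).toLinearMap z = z := by
  classical
  have hone : ∀ j, LinearMap.rTensor (Poly p n)
      (ExteriorAlgebra.map (coordKill p {j})).toLinearMap z = z := by
    intro j
    have hid : (LinearMap.id : Ext p n →ₗ[ZMod p] Ext p n) =
        (ExteriorAlgebra.map (coordKill p {j})).toLinearMap +
          ((LinearMap.mulLeft (ZMod p) (ExteriorAlgebra.ι (ZMod p) (Pi.single j 1))).comp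
            (ExteriorAlgebra.map (coordKill p {j})).toLinearMap).comp (contract p j) :=
      LinearMap.ext fun e => ext_eq_map_coordKill_add j e
    have h1 := congrArg (fun φ => LinearMap.rTensor (Poly p n) φ z) hid
    simp only [LinearMap.rTensor_add, LinearMap.rTensor_comp, LinearMap.add_apply,
      LinearMap.comp_apply, h j, map_zero, add_zero, LinearMap.rTensor_id, LinearMap.id_apply]
      at h1
    exact h1.symm
  induction s using Finset.induction_on with
  | empty =>
    have h1 : coordKill p (∅ : Finset (Fin n)) = LinearMap.id := by
      ext v i
      simp [coordKill_apply]
    rw [h1, ExteriorAlgebra.map_id]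
    exact LinearMap.rTensor_id_apply _ _ z
  | insert j s _ ih =>
    have h1 : coordKill p (insert j s) = (coordKill p {j}).comp (coordKill p s) := by
      refine LinearMap.ext fun v => funext fun i => ?_
      rw [LinearMap.comp_apply, coordKill_apply, coordKill_apply, coordKill_apply]
      simp only [Finset.mem_insert, Finset.mem_singleton]
      split_ifs <;> tauto
    rw [h1, ← ExteriorAlgebra.map_comp_map, AlgHom.comp_toLinearMap, LinearMap.rTensor_comp,
      LinearMap.comp_apply, ih, hone]

variable (p) in
/-- The projection of `E ⊗ P` onto `P`. -/
def toPoly (n : ℕ) : Coh p n →ₗ[ZMod p] Poly p n :=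
  (TensorProduct.lid (ZMod p) (Poly p n)).toLinearMap.comp
    (LinearMap.rTensor (Poly p n) ExteriorAlgebra.algebraMapInv.toLinearMap)

theorem toPoly_tmul {n : ℕ} (e : Ext p n) (f : Poly p n) :
    toPoly p n (e ⊗ₜ f) = ExteriorAlgebra.algebraMapInv e • f := by
  simp [toPoly]

theorem toPoly_one_tmul {n : ℕ} (f : Poly p n) : toPoly p n ((1 : Ext p n) ⊗ₜ f) = f := by
  rw [toPoly_tmul, map_one, one_smul]

/-- Such an element is fixed by setting all xⱼ to zero, and this substitution factors through the
augmentation of E. -/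
theorem eq_one_tmul_of_contract_eq_zero {n : ℕ} {z : Coh p n}
    (h : ∀ j, LinearMap.rTensor (Poly p n) (contract p j) z = 0) :
    z = (1 : Ext p n) ⊗ₜ toPoly p n z := by
  have h0 : coordKill p (Finset.univ : Finset (Fin n)) = 0 := by
    ext v i
    simp [coordKill_apply]
  have h1 : ExteriorAlgebra.map (0 : (Fin n → ZMod p) →ₗ[ZMod p] (Fin n → ZMod p)) =
      (Algebra.ofId (ZMod p) (Ext p n)).comp ExteriorAlgebra.algebraMapInv := by
    refine ExteriorAlgebra.hom_ext (LinearMap.ext fun v => ?_)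
    have : ExteriorAlgebra.algebraMapInv (ExteriorAlgebra.ι (ZMod p) v) = 0 := by
      simp [ExteriorAlgebra.algebraMapInv]
    simp [this]
  have h2 := rTensor_map_coordKill h Finset.univ
  rw [h0, h1] at h2
  conv_lhs => rw [← h2]
  generalize z = z'
  induction z' using TensorProduct.induction_on with
  | zero => simp
  | add x y hx hy => simp only [map_add, hx, hy, TensorProduct.tmul_add]
  | tmul e f =>
    rw [toPoly_tmul, LinearMap.rTensor_tmul, TensorProduct.tmul_smul, TensorProduct.smul_tmul']
    congr 1
    exact Algebra.algebraMap_eq_smul_one (R := ZMod p) (A := Ext p n) _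

/-- A nonzero subspace of `E ⊗ P` stable under the Steenrod operations contains a nonzero element
of `P`. -/
theorem exists_one_tmul_mem (hp : p ≠ 2) {n : ℕ} {N : Submodule (ZMod p) (Coh p n)}
    (hβ : ∀ z ∈ N, bockstein p n z ∈ N) (hP : ∀ k, ∀ z ∈ N, power p k n z ∈ N) {z : Coh p n}
    (hz : z ∈ N) (hz0 : z ≠ 0) : ∃ f : Poly p n, f ≠ 0 ∧ (1 : Ext p n) ⊗ₜ f ∈ N := by
  have hQ : ∀ i, ∀ z ∈ N, milnor p n i z ∈ N := by
    intro i
    induction i with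
    | zero => rw [milnor_zero]; exact hβ
    | succ i ih =>
      intro z hz
      rw [milnor_succ]
      exact N.sub_mem (hP _ _ (ih z hz)) (ih _ (hP _ z hz))
  -- Passing from w to Q_m w when the latter is nonzero keeps the earlier operations zero by
  -- anticommutation and adds Q_m, whose square is zero.
  have key : ∀ m, ∃ z ∈ N, z ≠ 0 ∧ ∀ i < m, milnor p n i z = 0 := by
    intro m
    induction m with
    | zero => exact ⟨z, hz, hz0, fun i hi => absurd hi (Nat.not_lt_zero i)⟩
    | succ m ih =>
      obtain ⟨w, hw, hw0, hwi⟩ := ih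
      by_cases h : milnor p n m w = 0
      · refine ⟨w, hw, hw0, fun i hi => ?_⟩
        rcases Nat.lt_succ_iff_lt_or_eq.1 hi with h1 | rfl
        · exact hwi i h1
        · exact h
      · refine ⟨milnor p n m w, hQ m w hw, h, fun i hi => ?_⟩
        rcases Nat.lt_succ_iff_lt_or_eq.1 hi with h1 | rfl
        · rw [milnor_milnor, hwi i h1, map_zero, neg_zero]
        · exact milnor_milnor_self hp _ _
  obtain ⟨w, hw, hw0, hwi⟩ := key n
  have h1 := eq_one_tmul_of_contract_eq_zero (rTensor_contract_eq_zero hwi)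
  refine ⟨toPoly p n w, fun h => hw0 ?_, h1 ▸ hw⟩
  rw [h1, h, TensorProduct.tmul_zero]

/-! ### Indecomposability -/

/-- A module is indecomposable if there are nonzero elements `x₀, x₁, …` almost all of which lie
in any given nonzero submodule. -/
theorem isIndecomposable_of_eventually_mem {R M : Type} [Ring R] [AddCommGroup M] [Module R M]
    (x : ℕ → M) (hx : ∀ k, x k ≠ 0)
    (h : ∀ N : Submodule R M, N ≠ ⊥ → ∃ K, ∀ k, K ≤ k → x k ∈ N) : IsIndecomposable R M := by
  refine ⟨⟨⟨x 0, 0, hx 0⟩⟩, fun N N' hN => ?_⟩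
  by_contra! hcon
  obtain ⟨h1, h2⟩ := hcon
  have h3 : N' ≠ ⊥ := by
    rintro rfl
    exact h2 (by simpa using hN.sup_eq_top)
  obtain ⟨K, hK⟩ := h N h1
  obtain ⟨K', hK'⟩ := h N' h3
  exact hx (max K K') (Submodule.disjoint_def.1 hN.disjoint _ (hK _ (le_max_left _ _))
    (hK' _ (le_max_right _ _)))

/-- The underlying subspace of a submodule over an algebra of operations. -/
def OperationAlgebra.toSubspace {F : Type} [Field F] {H : ℕ → Type} [∀ n, AddCommGroup (H n)]
    [∀ n, Module F (H n)] {s : Set (∀ n, Module.End F (H n))} {n : ℕ}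
    (N : @Submodule (OperationAlgebra F H s) (H n) _ _ (OperationAlgebra.module s n)) :
    Submodule F (H n) :=
  letI := OperationAlgebra.module s n
  { carrier := N
    add_mem' := N.add_mem
    zero_mem' := N.zero_mem
    smul_mem' := fun c _ hx => N.smul_mem (algebraMap F (Algebra.adjoin F s) c) hx }

theorem OperationAlgebra.apply_mem {F : Type} [Field F] {H : ℕ → Type} [∀ n, AddCommGroup (H n)]
    [∀ n, Module F (H n)] {s : Set (∀ n, Module.End F (H n))} {n : ℕ}
    (N : @Submodule (OperationAlgebra F H s) (H n) _ _ (OperationAlgebra.module s n))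
    {θ : ∀ n, Module.End F (H n)} (hθ : θ ∈ s) {x : H n}
    (hx : x ∈ OperationAlgebra.toSubspace N) : θ n x ∈ OperationAlgebra.toSubspace N :=
  letI := OperationAlgebra.module s n
  N.smul_mem (⟨θ, Algebra.subset_adjoin hθ⟩ : Algebra.adjoin F s) hx

theorem eulerClass_pow_mem (n k : ℕ) : eulerClass p n ^ p ^ k ∈ ClassicalDickson p n :=
  pow_mem (eulerClass_mem p n) _

theorem polyAug_eulerClass_pow {n : ℕ} (hn : 1 ≤ n) (k : ℕ) :
    polyAug p n (eulerClass p n ^ p ^ k) = 0 := by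
  have h := map_dvd (polyAug p n) (X_dvd_eulerClass p (⟨0, hn⟩ : Fin n))
  have h0 : polyAug p n (eulerClass p n) = 0 := by
    rw [polyAug, MvPolynomial.aeval_X] at h
    exact zero_dvd_iff.1 h
  rw [map_pow, h0, zero_pow (pow_pos (Fact.out : p.Prime).pos k).ne']

theorem isIndecomposable_classicalAugmentationIdeal {n : ℕ} (hn : 1 ≤ n) :
    IsIndecomposable (ReducedPowerAlgebra p) (classicalAugmentationIdeal p n) := by
  refine isIndecomposable_of_eventually_mem
    (fun k => ⟨eulerClass p n ^ p ^ k, eulerClass_pow_mem n k, polyAug_eulerClass_pow hn k⟩)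
    (fun k h => pow_ne_zero (p ^ k) (eulerClass_ne_zero p n) (congrArg Subtype.val h)) ?_
  intro N hN
  obtain ⟨x, hx, hx0⟩ := Submodule.exists_mem_ne_zero_of_ne_bot hN
  let W := OperationAlgebra.toSubspace (N.map (classicalAugmentationIdeal p n).subtype)
  have hW : PowerStable p W := fun k f hf =>
    OperationAlgebra.apply_mem (s := Set.range (polyPower p)) _ ⟨k, rfl⟩ hf
  have hxW : x.1 ∈ W := ⟨x, hx, rfl⟩
  obtain ⟨K, hK⟩ := hW.exists_forall_eulerClass_pow_mem hn hxW
    (fun h => hx0 (Subtype.ext h)) x.2.1 x.2.2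
  refine ⟨K, fun k hk => ?_⟩
  obtain ⟨y, hy, hyk⟩ := hK k hk
  have hy' : y ∈ N := hy
  convert hy' using 1
  exact Subtype.ext hyk.symm

theorem mem_classicalDickson_of_one_tmul_mem {n : ℕ} {f : Poly p n}
    (hf : (1 : Ext p n) ⊗ₜ f ∈ ExtendedDickson p n) : f ∈ ClassicalDickson p n := by
  refine (mem_classicalDickson p).2 fun g => ?_
  have h := (mem_extendedDickson p).1 hf g
  rw [act, Algebra.TensorProduct.map_tmul, map_one] at h
  simpa only [toPoly_one_tmul] using congrArg (toPoly p n) h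

theorem one_tmul_mem_extendedDickson {n : ℕ} {f : Poly p n} (hf : f ∈ ClassicalDickson p n) :
    (1 : Ext p n) ⊗ₜ f ∈ ExtendedDickson p n := by
  refine (mem_extendedDickson p).2 fun g => ?_
  rw [act, Algebra.TensorProduct.map_tmul, map_one, (mem_classicalDickson p).1 hf g]

theorem aug_one_tmul {n : ℕ} (f : Poly p n) : aug p n ((1 : Ext p n) ⊗ₜ f) = polyAug p n f := by
  simp [aug]

theorem isIndecomposable_extendedAugmentationIdeal (hp : p ≠ 2) {n : ℕ} (hn : 1 ≤ n) :
    IsIndecomposable (SteenrodAlgebra p) (extendedAugmentationIdeal p n) := by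
  refine isIndecomposable_of_eventually_mem
    (fun k => ⟨(1 : Ext p n) ⊗ₜ (eulerClass p n ^ p ^ k),
      one_tmul_mem_extendedDickson (eulerClass_pow_mem n k),
      (aug_one_tmul _).trans (polyAug_eulerClass_pow hn k)⟩)
    (fun k h => pow_ne_zero (p ^ k) (eulerClass_ne_zero p n) ?_) ?_
  · have h1 := congrArg (toPoly p n) (congrArg Subtype.val h)
    rwa [toPoly_one_tmul, ZeroMemClass.coe_zero, map_zero] at h1
  intro N hN
  obtain ⟨x, hx, hx0⟩ := Submodule.exists_mem_ne_zero_of_ne_bot hN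
  let V := OperationAlgebra.toSubspace (N.map (extendedAugmentationIdeal p n).subtype)
  have hP : ∀ k, ∀ z ∈ V, power p k n z ∈ V := fun k z hz =>
    OperationAlgebra.apply_mem (s := insert (bockstein p) (Set.range (power p))) _
      (Set.mem_insert_of_mem _ ⟨k, rfl⟩) hz
  have hβ : ∀ z ∈ V, bockstein p n z ∈ V := fun z hz =>
    OperationAlgebra.apply_mem (s := insert (bockstein p) (Set.range (power p))) _
      (Set.mem_insert _ _) hz
  have hxV : x.1 ∈ V := ⟨x, hx, rfl⟩
  obtain ⟨f, hf0, hfV⟩ := exists_one_tmul_mem hp hβ hP hxV fun h => hx0 (Subtype.ext h)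
  have hfmem : (1 : Ext p n) ⊗ₜ f ∈ extendedAugmentationIdeal p n := by
    obtain ⟨y, -, hy⟩ := hfV
    rw [← hy]
    exact y.2
  -- The part of V inside 1 ⊗ P, where the reduced powers act as on P.
  let W : Submodule (ZMod p) (Poly p n) := V.comap (TensorProduct.mk (ZMod p) (Ext p n) _ 1)
  have hW : PowerStable p W := fun k g hg => hP k _ hg
  obtain ⟨K, hK⟩ := hW.exists_forall_eulerClass_pow_mem hn hfV hf0
    (mem_classicalDickson_of_one_tmul_mem hfmem.1) ((aug_one_tmul f).symm.trans hfmem.2)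
  refine ⟨K, fun k hk => ?_⟩
  obtain ⟨y, hy, hyk⟩ := hK k hk
  have hy' : y ∈ N := hy
  convert hy' using 1
  exact Subtype.ext hyk.symm

end Dickson

end

theorem mainTheorem4 (p : ℕ) [Fact p.Prime] (n : ℕ) (hn : 1 ≤ n) :
    (p ≠ 2 →
      Dickson.IsIndecomposable (Dickson.SteenrodAlgebra p)
        (Dickson.extendedAugmentationIdeal p n)) ∧
    Dickson.IsIndecomposable (Dickson.ReducedPowerAlgebra p)
      (Dickson.classicalAugmentationIdeal p n) :=
  ⟨fun hp => Dickson.isIndecomposable_extendedAugmentationIdeal hp hn,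
    Dickson.isIndecomposable_classicalAugmentationIdeal hn⟩
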